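/- Let $A$ be a commutative $\mathbb{Q}$-algebra ("functions of the times $t=(t_1=x,t_3,t_5,\dots)$", for instance formal power series in $t$) with pairwise commuting derivations $\partial_{2n+1}=\partial/\partial t_{2n+1}$, $n\ge 0$, and write $\partial=\partial_1=\partial/\partial x$, $f_x=\partial f$. Let $L=\partial+u_1\partial^{-1}+u_2\partial^{-2}+\cdots$ be a pseudo-differential operator with coefficients in $A$ that solves the BKP hierarchy: $$L^*=-\partial L\partial^{-1},\qquad \partial_{2n+1}L=[B_{2n+1},L],\qquad B_{2n+1}=(L^{2n+1})_+,\qquad n\ge 0,$$ where $L^*$ is the formal adjoint and $(\cdot)_+$ the differential part. An element $\Phi\in A$ is an eigenfunction if $\partial_{2n+1}\Phi=B_{2n+1}(\Phi)$ for all $n\ge0$. A squared eigenfunction potential $S(\Phi,\Psi)$ is an element of $A$ with $$\partial_{2n+1}S(\Phi,\Psi)=\operatorname{Res}\big(\partial^{-1}\Psi B_{2n+1}\Phi\,\partial^{-1}\big)\quad\text{for all } n\ge 0,$$ where $\operatorname{Res}$ is the coefficient of $\partial^{-1}$; it is determined up to a constant of integration. For $f\in A$ the shifted function $f(t\mp2[z^{-1}])$,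 where $[z^{-1}]=(z^{-1},\tfrac13z^{-3},\tfrac15z^{-5},\dots)$, is the formal Taylor series $$f(t\mp2[z^{-1}])=\exp\Big(\mp\sum_{l\ge1}\frac{2}{2l-1}z^{-(2l-1)}\partial_{2l-1}\Big)f\in A[[z^{-1}]].$$ **Proposition.** Let $\Phi_1,\Phi_2$ be eigenfunctions and let $$\Omega=\Omega(\Phi_1,\Phi_2)=S(\Phi_2,\Phi_{1x})-S(\Phi_1,\Phi_{2x})$$ for any choice of the two potentials in $A$ (that is, of their constants of integration). Then in $A[[z^{-1}]]$ $$\Omega(t-2[z^{-1}])-\Omega(t)=\Phi_1(t-2[z^{-1}])\Phi_2(t)-\Phi_1(t)\Phi_2(t-2[z^{-1}]),$$ $$\Omega(t+2[z^{-1}])-\Omega(t)=\Phi_1(t+2[z^{-1}])\Phi_2(t)-\Phi_1(t)\Phi_2(t+2[z^{-1}]).$$ -/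

import Mathlib

noncomputable section

/-- Pseudo-differential operators `∑ i ≤ N, a i ∂^i` with coefficients in `A`: families
`i ↦ a i` indexed by `ℤ` that vanish for all large `i`. -/
@[ext]
structure PDO (A : Type*) [CommRing A] where
  coeff : ℤ → A
  bounded : ∃ N : ℤ, ∀ i : ℤ, N < i → coeff i = 0

namespace PDO

variable {A : Type*} [CommRing A]

/-- The operator `a ∂^i`. -/
def monomial (a : A) (i : ℤ) : PDO A where
  coeff j := if j = i then a else 0
  bounded := ⟨i, fun _ hj => if_neg hj.ne'⟩

/-- The operator of multiplication by the function `a`. -/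
def func (a : A) : PDO A := monomial a 0

/-- The power `∂^i`, for any integer `i`. -/
def partialPow (i : ℤ) : PDO A := monomial 1 i

/-- The differential part `P₊ = ∑ i ≥ 0, a i ∂^i`. -/
def plus (P : PDO A) : PDO A where
  coeff i := if 0 ≤ i then P.coeff i else 0
  bounded := by
    obtain ⟨N, hN⟩ := P.bounded
    exact ⟨N, fun i hi => by simp [hN i hi]⟩

/-- The residue, that is, the coefficient of `∂^(-1)`. -/
def res (P : PDO A) : A := P.coeff (-1)

variable [Algebra ℚ A] (d : Derivation ℚ A A)

/-- The product determined by `∂^i ∘ b = ∑ k ≥ 0, (i choose k) b^(k) ∂^(i-k)`, with the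
generalized binomial coefficient for integers `i` of either sign, where `b^(k) = d^k b`.
The coefficient of `∂^n` is the sum over `i` and `k` of
`(i choose k) a i (b j)^(k)` with `j = n - i + k`; only finitely many terms are non-zero. -/
def mul (P Q : PDO A) : PDO A where
  coeff n := ∑ᶠ p : ℤ × ℕ,
    Ring.choose p.1 p.2 • (P.coeff p.1 * (⇑d)^[p.2] (Q.coeff (n - p.1 + p.2)))
  bounded := by
    obtain ⟨M, hM⟩ := P.bounded
    obtain ⟨N, hN⟩ := Q.bounded
    refine ⟨M + N, fun n hn => ?_⟩
    have key : ∀ p : ℤ × ℕ,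
        Ring.choose p.1 p.2 • (P.coeff p.1 * (⇑d)^[p.2] (Q.coeff (n - p.1 + p.2))) = 0 := by
      intro p
      by_cases hp : M < p.1
      · simp [hM _ hp]
      · rw [hN (n - p.1 + p.2) (by omega), iterate_map_zero]
        simp
    simp [key]

/-- The family of terms in the definition of the product has finite support. -/
theorem mul_finite_support (P Q : PDO A) (n : ℤ) :
    (Function.support fun p : ℤ × ℕ =>
      Ring.choose p.1 p.2 • (P.coeff p.1 * (⇑d)^[p.2] (Q.coeff (n - p.1 + p.2)))).Finite := by
  obtain ⟨M, hM⟩ := P.bounded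
  obtain ⟨N, hN⟩ := Q.bounded
  refine ((Set.finite_Icc (n - N) M).prod (Set.finite_Iic (N - n + M).toNat)).subset ?_
  intro p hp
  have h1 : p.1 ≤ M := by
    by_contra h
    exact hp (by simp [hM p.1 (by omega)])
  have h2 : n - p.1 + p.2 ≤ N := by
    by_contra h
    refine hp ?_
    simp only
    rw [hN (n - p.1 + p.2) (by omega), iterate_map_zero]
    simp
  simp only [Set.mem_prod, Set.mem_Icc, Set.mem_Iic]
  omega

/-- Powers `P^m`. -/
def pow (P : PDO A) : ℕ → PDO A
  | 0 => partialPow 0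
  | m + 1 => mul d (pow P m) P

/-- The formal adjoint `P* = ∑ i, (-1)^i ∂^i ∘ a i`, whose coefficient of `∂^n` is
`∑ k ≥ 0, (-1)^(n+k) ((n+k) choose k) (a (n+k))^(k)`. -/
def adjoint (P : PDO A) : PDO A where
  coeff n := ∑ᶠ k : ℕ,
    ((n + k).negOnePow : ℤ) • Ring.choose (n + k) k • (⇑d)^[k] (P.coeff (n + k))
  bounded := by
    obtain ⟨N, hN⟩ := P.bounded
    refine ⟨N, fun n hn => ?_⟩
    have key : ∀ k : ℕ,
        ((n + k).negOnePow : ℤ) • Ring.choose (n + k) k • (⇑d)^[k] (P.coeff (n + k)) = 0 := by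
      intro k
      rw [hN (n + k) (by omega), iterate_map_zero]
      simp
    simp only [key, finsum_zero]

/-- The action `P(f) = ∑ i ≥ 0, a i f^(i)` of a differential operator on a function
(the coefficients of negative powers of `∂` are not used). -/
def apply (P : PDO A) (f : A) : A := ∑ᶠ i : ℕ, P.coeff i * (⇑d)^[i] f

end PDO

namespace BKP

open PDO

variable {A : Type*} [CommRing A] [Algebra ℚ A]

/-- In this namespace `D n` is the derivation `∂/∂t_(2n+1)`; thus `D 0 = ∂ = ∂/∂x`.
The operator `B_(2n+1) = (L^(2n+1))₊`. -/
def B (D : ℕ → Derivation ℚ A A) (L : PDO A) (n : ℕ) : PDO A :=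
  plus (pow (D 0) L (2 * n + 1))

/-- `L = ∂ + u₁ ∂^(-1) + u₂ ∂^(-2) + ⋯` is a solution of the BKP hierarchy: it satisfies the
constraint `L* = - ∂ L ∂^(-1)` and the Lax equations `∂L/∂t_(2n+1) = [B_(2n+1), L]`. -/
structure IsLax (D : ℕ → Derivation ℚ A A) (L : PDO A) : Prop where
  coeff_of_one_lt : ∀ i : ℤ, 1 < i → L.coeff i = 0
  coeff_one : L.coeff 1 = 1
  coeff_zero : L.coeff 0 = 0
  adjoint_eq : ∀ i : ℤ, (adjoint (D 0) L).coeff i =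
    -(mul (D 0) (mul (D 0) (partialPow 1) L) (partialPow (-1))).coeff i
  lax : ∀ (n : ℕ) (i : ℤ), D n (L.coeff i) =
    (mul (D 0) (B D L n) L).coeff i - (mul (D 0) L (B D L n)).coeff i

/-- `Φ` is an eigenfunction: `∂Φ/∂t_(2n+1) = B_(2n+1)(Φ)` for all `n`. -/
def IsEigenfunction (D : ℕ → Derivation ℚ A A) (L : PDO A) (Φ : A) : Prop :=
  ∀ n : ℕ, D n Φ = apply (D 0) (B D L n) Φ

/-- `S` is a squared eigenfunction potential `S(Φ, Ψ)`:
`∂S/∂t_(2n+1) = Res (∂^(-1) Ψ B_(2n+1) Φ ∂^(-1))` for all `n`. These equations determine it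
up to a constant of integration. -/
def IsSEP (D : ℕ → Derivation ℚ A A) (L : PDO A) (Φ Ψ S : A) : Prop :=
  ∀ n : ℕ, D n S =
    res (mul (D 0) (mul (D 0) (mul (D 0) (mul (D 0)
      (partialPow (-1)) (func Ψ)) (B D L n)) (func Φ)) (partialPow (-1)))

/-- `Ω` is a value of the BSEP `Ω(Φ₁, Φ₂) = S(Φ₂, Φ₁ₓ) - S(Φ₁, Φ₂ₓ)`, for some choice of the
constants of integration in the two potentials. -/
def IsBSEP (D : ℕ → Derivation ℚ A A) (L : PDO A) (Φ₁ Φ₂ Ω : A) : Prop :=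
  ∃ S₂₁ S₁₂ : A, IsSEP D L Φ₂ (D 0 Φ₁) S₂₁ ∧ IsSEP D L Φ₁ (D 0 Φ₂) S₁₂ ∧ Ω = S₂₁ - S₁₂

/-- The formal series `∑ n, (c / (2n+1)) z^(-(2n+1)) ∂/∂t_(2n+1)` in the variable `z^(-1)`. -/
def shiftField (D : ℕ → Derivation ℚ A A) (c : ℚ) : PowerSeries (Module.End ℚ A) :=
  PowerSeries.mk fun k => if Odd k then (c / k) • (D (k / 2) : A →ₗ[ℚ] A) else 0

/-- The shifted function `f(t + c [z⁻¹])`, where `[z⁻¹] = (z⁻¹, z⁻³/3, z⁻⁵/5, …)`, as its formal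
Taylor expansion `exp (∑ n, (c / (2n+1)) z^(-(2n+1)) ∂/∂t_(2n+1)) f`, a formal power series in
`z⁻¹`. As the exponent has no constant term, its `m`-th power contributes to the coefficient
of `z^(-k)` only for `m ≤ k`. -/
def shift (D : ℕ → Derivation ℚ A A) (c : ℚ) (f : A) : PowerSeries A :=
  PowerSeries.mk fun k => ∑ m ∈ Finset.range (k + 1),
    ((m.factorial : ℚ)⁻¹) • (PowerSeries.coeff k (shiftField D c ^ m)) f

end BKP

end

/-! Put `X` for z⁻¹ and let E = X d/dX - 2 ∑ X^(2n+1) ∂_(2n+1) act on power series. As the flows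
commute, F = f(t + 2[z⁻¹]) satisfies E F = 0 with constant term f, and over ℚ this determines F
(`smul_coeff_shift`, `eq_zero_of_evol`). So the formula for +2 follows once E kills the difference
of its two sides, the constant terms being equal. The formula for -2 is its image under X ↦ -X.

No tau function or dressing operator is used. Let B = ∑ B_(2n+1) X^(2n+1), and let P solve E P = 2 P
B with P = 1 at X = 0. Its coefficients are differential operators, and P(Φ) = Φ(t + 2[z⁻¹]) for
every eigenfunction Φ (`value_eq_shift`). The BKP constraint gives B(1) = 0, hence P(1) = 1. The Lax
equations give P (1 - X L) = (1 + Z)(1 + X L) with Z of negative order (`IsLax.exists_isShiftOp`).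

A series of differential operators that kill constants vanishes once its product with 1 - X L has
order at most 0. Comparing the coefficients of ∂ therefore yields functions u, v with X ∂ (P + 1) =
u (P - 1) and (X ∂ + u) B = v (P - 1) (`IsShiftOp.exists_first`, `IsShiftOp.exists_second`).
Together they integrate the operator f_x B explicitly: ∂ (B(f) (P + 1) - (P(f) - f) B) = 2 (∂(B(f))
+ f_x B). Applying ∂⁻¹ and taking the constant coefficient on g expresses the residues that define
S(g, f_x) as 2 Res = B(f) (P(g) + g) - (P(f) - f) B(g) (`two_nsmul_resSeries`). Antisymmetrizing in
f and g gives exactly the equation required of Ω. -/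

open PowerSeries
open Finset.HasAntidiagonal

noncomputable section

/-! ### The ring of pseudo-differential operators -/

namespace PDO

variable {A : Type*} [CommRing A] [Algebra ℚ A]

/-- Families indexed by `ℤ` that vanish for all large indices. -/
def boundedFamilies (A : Type*) [CommRing A] [Algebra ℚ A] : Submodule ℚ (ℤ → A) where
  carrier := {f | ∃ N : ℤ, ∀ i : ℤ, N < i → f i = 0}
  add_mem' := by
    rintro f g ⟨M, hM⟩ ⟨N, hN⟩
    exact ⟨max M N, fun i hi => by
      simp [hM i (lt_of_le_of_lt (le_max_left _ _) hi),
        hN i (lt_of_le_of_lt (le_max_right _ _) hi)]⟩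
  zero_mem' := ⟨0, fun _ _ => rfl⟩
  smul_mem' := by
    rintro c f ⟨N, hN⟩
    exact ⟨N, fun i hi => by simp [hN i hi]⟩

/-- Pseudo-differential operators, carrying the ring structure determined by `d`. -/
def Op (_d : Derivation ℚ A A) : Type _ := PDO A

namespace Op

variable {d : Derivation ℚ A A}

/-- Operators as families of coefficients. -/
def equivFamilies : Op d ≃ boundedFamilies A where
  toFun P := ⟨PDO.coeff P, PDO.bounded P⟩
  invFun f := ⟨f.1, f.2⟩
  left_inv _ := rfl
  right_inv _ := rfl

instance : AddCommGroup (Op d) := equivFamilies.addCommGroup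

instance : Module ℚ (Op d) := equivFamilies.module ℚ

/-- The coefficient of `∂^i`. -/
def cf (i : ℤ) : Op d →ₗ[ℚ] A where
  toFun P := PDO.coeff P i
  map_add' _ _ := rfl
  map_smul' _ _ := rfl

@[ext]
theorem ext {P Q : Op d} (h : ∀ i, cf i P = cf i Q) : P = Q :=
  PDO.ext (funext h)

/-- The operator with given coefficients. -/
def mk (P : PDO A) : Op d := P

@[simp] theorem cf_mk (P : PDO A) (i : ℤ) : cf i (mk P : Op d) = P.coeff i := rfl

/-- The operator `a ∂^i`. -/
def mon (a : A) (i : ℤ) : Op d := mk (monomial a i)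

@[simp] theorem cf_mon (a : A) (i n : ℤ) : cf n (mon a i : Op d) = if n = i then a else 0 := rfl

instance : Mul (Op d) := ⟨fun P Q => PDO.mul d P Q⟩

instance : One (Op d) := ⟨mon 1 0⟩

theorem one_def : (1 : Op d) = mon 1 0 := rfl

theorem cf_mul (P Q : Op d) (n : ℤ) : cf n (P * Q) = ∑ᶠ p : ℤ × ℕ,
    Ring.choose p.1 p.2 • (cf p.1 P * (⇑d)^[p.2] (cf (n - p.1 + p.2) Q)) := rfl

theorem finite_support_mul (P Q : Op d) (n : ℤ) : (Function.support fun p : ℤ × ℕ =>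
    Ring.choose p.1 p.2 • (cf p.1 P * (⇑d)^[p.2] (cf (n - p.1 + p.2) Q))).Finite :=
  PDO.mul_finite_support d P Q n

theorem left_distrib' (P Q R : Op d) : P * (Q + R) = P * Q + P * R := by
  ext n
  rw [map_add, cf_mul, cf_mul, cf_mul,
    ← finsum_add_distrib (finite_support_mul P Q n) (finite_support_mul P R n)]
  refine finsum_congr fun p => ?_
  rw [map_add, iterate_map_add, mul_add, smul_add]

theorem right_distrib' (P Q R : Op d) : (P + Q) * R = P * R + Q * R := by
  ext n
  rw [map_add, cf_mul, cf_mul, cf_mul,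
    ← finsum_add_distrib (finite_support_mul P R n) (finite_support_mul Q R n)]
  refine finsum_congr fun p => ?_
  rw [map_add, add_mul, smul_add]

instance : NonUnitalNonAssocRing (Op d) where
  left_distrib := left_distrib'
  right_distrib := right_distrib'
  zero_mul P := by
    have h := right_distrib' 0 0 P
    rw [add_zero] at h
    exact left_eq_add.mp h
  mul_zero P := by
    have h := left_distrib' P 0 0
    rw [add_zero] at h
    exact left_eq_add.mp h

/-- Operators of order at most `N`. -/
def ordLE (d : Derivation ℚ A A) (N : ℤ) : Submodule ℚ (Op d) where
  carrier := {P | ∀ i, N < i → cf i P = 0}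
  add_mem' hP hQ i hi := by rw [map_add, hP i hi, hQ i hi, add_zero]
  zero_mem' i _ := map_zero _
  smul_mem' c P hP i hi := by rw [map_smul, hP i hi, smul_zero]

theorem exists_mem_ordLE (P : Op d) : ∃ N, P ∈ ordLE d N := PDO.bounded P

theorem ordLE_mono {M N : ℤ} (h : M ≤ N) : ordLE d M ≤ ordLE d N :=
  fun _ hP i hi => hP i (h.trans_lt hi)

theorem mon_mem_ordLE (a : A) (i : ℤ) : (mon a i : Op d) ∈ ordLE d i := by
  intro n hn
  rw [cf_mon, if_neg hn.ne']

theorem mul_mem_ordLE {P Q : Op d} {M N : ℤ} (hP : P ∈ ordLE d M) (hQ : Q ∈ ordLE d N) :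
    P * Q ∈ ordLE d (M + N) := by
  intro n hn
  rw [cf_mul]
  refine finsum_eq_zero_of_forall_eq_zero fun p => ?_
  by_cases hp : M < p.1
  · rw [hP _ hp, zero_mul, smul_zero]
  · rw [hQ (n - p.1 + p.2) (by omega), iterate_map_zero, mul_zero, smul_zero]

/-- An additive map that respects the order filtration up to a shift is zero as soon as it
kills the operators `a ∂^i`. -/
theorem eq_zero_of_mon (T : Op d →+ Op d) (c : ℤ)
    (hT : ∀ N P, P ∈ ordLE d N → T P ∈ ordLE d (N + c)) (h : ∀ a i, T (mon a i) = 0)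
    (P : Op d) : T P = 0 := by
  obtain ⟨N, hN⟩ := exists_mem_ordLE P
  -- Subtracting the leading monomial does not change the image, so P may be replaced by an operator
  -- of order as low as desired, and each coefficient of `T P` then vanishes.
  have key : ∀ m : ℕ, ∃ Q ∈ ordLE d (N - m), T P = T Q := by
    intro m
    induction m with
    | zero => exact ⟨P, by simpa using hN, rfl⟩
    | succ m ih =>
      obtain ⟨Q, hQ, hPQ⟩ := ih
      refine ⟨Q - mon (cf (N - m) Q) (N - m), ?_, by rw [map_sub, h, sub_zero, hPQ]⟩
      intro i hi
      rw [map_sub, cf_mon]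
      split_ifs with h'
      · rw [h', sub_self]
      · rw [hQ i (by push_cast at hi; omega), sub_zero]
  ext i
  obtain ⟨Q, hQ, hPQ⟩ := key (N + c + 1 - i).toNat
  rw [hPQ, hT _ _ hQ i (by omega), map_zero]

theorem cf_mon_mul (a : A) (i : ℤ) (Q : Op d) (n : ℤ) : cf n (mon a i * Q) =
    ∑ᶠ k : ℕ, Ring.choose i k • (a * (⇑d)^[k] (cf (n - i + k) Q)) := by
  rw [cf_mul, finsum_curry _ (finite_support_mul (mon a i) Q n), finsum_eq_single _ i]
  · simp only [cf_mon, if_true]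
  · intro p hp
    simp only [cf_mon, if_neg hp, zero_mul, smul_zero, finsum_zero]

theorem cf_func_mul (a : A) (Q : Op d) (n : ℤ) : cf n (mon a 0 * Q) = a * cf n Q := by
  rw [cf_mon_mul, finsum_eq_single _ 0]
  · simp
  · intro k hk
    obtain ⟨k, rfl⟩ := Nat.exists_eq_succ_of_ne_zero hk
    simp [Ring.choose_zero_succ]

theorem cf_D_mul (Q : Op d) (n : ℤ) : cf n (mon 1 1 * Q) = d (cf n Q) + cf (n - 1) Q := by
  rw [cf_mon_mul, finsum_eq_sum_of_support_subset (s := {0, 1})]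
  · simp [add_comm]
  · intro k hk
    by_contra hk'
    refine hk ?_
    obtain ⟨k, rfl⟩ : ∃ m, k = m + 2 := ⟨k - 2, by simp at hk'; omega⟩
    have : Ring.choose (1 : ℤ) (k + 2) = 0 := by
      rw [← Nat.cast_one, Ring.choose_natCast, Nat.choose_eq_zero_of_lt (by omega), Nat.cast_zero]
    simp [this]

theorem cf_mul_mon_one (P : Op d) (j n : ℤ) : cf n (P * mon 1 j) = cf (n - j) P := by
  rw [cf_mul, finsum_eq_single _ (n - j, 0)]
  · simp
  · rintro ⟨i, k⟩ h
    rw [cf_mon]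
    simp only
    split_ifs with h'
    · rcases k with _ | k
      · exact (h (by rw [Prod.mk.injEq]; constructor <;> simp at h' ⊢; omega)).elim
      · rw [Function.iterate_succ_apply, d.map_one_eq_zero, iterate_map_zero, mul_zero, smul_zero]
    · rw [iterate_map_zero, mul_zero, smul_zero]

theorem mul_one' (P : Op d) : P * 1 = P := by
  ext n
  rw [one_def, cf_mul_mon_one, sub_zero]

theorem one_mul' (P : Op d) : 1 * P = P := by
  ext n
  rw [one_def, cf_func_mul, one_mul]

theorem cf_mon_mul_mon (a b : A) (i j n : ℤ) : cf n (mon a i * mon b j : Op d) =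
    if n ≤ i + j then Ring.choose i (i + j - n).toNat • (a * (⇑d)^[(i + j - n).toNat] b)
    else 0 := by
  rw [cf_mon_mul, finsum_eq_single _ (i + j - n).toNat]
  · rw [cf_mon]
    split_ifs with h1 h2 h2
    · rfl
    · omega
    · omega
    · rw [iterate_map_zero, mul_zero, smul_zero]
  · intro k hk
    rw [cf_mon, if_neg (by omega), iterate_map_zero, mul_zero, smul_zero]

/-- If left multiplication by `P` is associative on the operators `a ∂^i`, then it is associative. -/
theorem mul_assoc_of_mon (P : Op d)
    (h : ∀ a i b j, P * mon a i * mon b j = P * (mon a i * mon b j)) (Q R : Op d) :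
    P * Q * R = P * (Q * R) := by
  obtain ⟨M, hM⟩ := exists_mem_ordLE P
  have h1 : ∀ a i R, P * mon a i * R = P * (mon a i * R) := by
    intro a i R
    rw [← sub_eq_zero]
    refine eq_zero_of_mon (AddMonoidHom.mulLeft (P * mon a i) -
      (AddMonoidHom.mulLeft P).comp (AddMonoidHom.mulLeft (mon a i))) (M + i) ?_
      (fun b j => sub_eq_zero.mpr (h a i b j)) R
    intro N S hS
    have := sub_mem (mul_mem_ordLE (mul_mem_ordLE hM (mon_mem_ordLE a i)) hS)
      (ordLE_mono (by omega) (mul_mem_ordLE hM (mul_mem_ordLE (mon_mem_ordLE a i) hS)))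
    exact ordLE_mono (by omega) this
  obtain ⟨N, hN⟩ := exists_mem_ordLE R
  rw [← sub_eq_zero]
  refine eq_zero_of_mon ((AddMonoidHom.mulRight R).comp (AddMonoidHom.mulLeft P) -
    (AddMonoidHom.mulLeft P).comp (AddMonoidHom.mulRight R)) (M + N) ?_
    (fun a i => sub_eq_zero.mpr (h1 a i R)) Q
  intro K S hS
  have := sub_mem (mul_mem_ordLE (mul_mem_ordLE hM hS) hN)
    (ordLE_mono (by omega) (mul_mem_ordLE hM (mul_mem_ordLE hS hN)))
  exact ordLE_mono (by omega) this

theorem func_mul_assoc (a : A) (Q R : Op d) : mon a 0 * Q * R = mon a 0 * (Q * R) := by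
  ext n
  rw [cf_func_mul, cf_mul, cf_mul, mul_finsum' _ _ (finite_support_mul Q R n)]
  refine finsum_congr fun p => ?_
  rw [cf_func_mul, mul_smul_comm, mul_assoc]

theorem D_mul_mon (b : A) (j : ℤ) :
    (mon 1 1 * mon b j : Op d) = mon (d b) j + mon b (j + 1) := by
  ext n
  rw [cf_D_mul, map_add, cf_mon, cf_mon, cf_mon, cf_mon, apply_ite d, map_zero]
  simp only [sub_eq_iff_eq_add]

/-- On monomials this is the Leibniz rule for `d` combined with Pascal's rule for the generalized
binomial coefficients. -/
theorem D_mul_assoc (Q R : Op d) : mon 1 1 * Q * R = mon 1 1 * (Q * R) := by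
  refine mul_assoc_of_mon _ (fun b j c k => ?_) Q R
  ext n
  rw [D_mul_mon, add_mul, map_add, cf_D_mul, cf_mon_mul_mon, cf_mon_mul_mon, cf_mon_mul_mon,
    cf_mon_mul_mon]
  rcases lt_trichotomy n (j + k + 1) with hn | rfl | hn
  · obtain ⟨m, hm⟩ : ∃ m : ℕ, j + k - n = m := ⟨(j + k - n).toNat, by omega⟩
    rw [if_pos (by omega), if_pos (by omega), if_pos (by omega), if_pos (by omega), hm,
      show j + 1 + k - n = ((m + 1 : ℕ) : ℤ) by push_cast; omega,
      show j + k - (n - 1) = ((m + 1 : ℕ) : ℤ) by push_cast; omega, Int.toNat_natCast,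
      Int.toNat_natCast, Ring.choose_succ_succ, map_zsmul, d.leibniz,
      Function.iterate_succ_apply']
    simp only [smul_eq_mul, add_smul, smul_add]
    rw [mul_comm (d b)]
    abel
  · rw [if_neg (by omega), if_pos (by omega), if_neg (by omega), if_pos (by omega), map_zero,
      show j + 1 + k - (j + k + 1) = 0 by omega, show j + k - (j + k + 1 - 1) = 0 by omega]
    simp
  · rw [if_neg (by omega), if_neg (by omega), if_neg (by omega), if_neg (by omega), map_zero]

theorem mon_one_mul_mon_one (i j : ℤ) : (mon 1 i * mon 1 j : Op d) = mon 1 (i + j) := by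
  ext n
  rw [cf_mul_mon_one, cf_mon, cf_mon]
  simp only [sub_eq_iff_eq_add]

theorem D_mul_Dinv_mul (Q : Op d) : mon 1 1 * (mon 1 (-1) * Q) = Q := by
  rw [← D_mul_assoc, mon_one_mul_mon_one, add_neg_cancel, ← one_def, one_mul']

/-- The leading coefficient of ∂S is that of S, so ∂S = 0 lowers any bound on the order of S
indefinitely. -/
theorem D_mul_injective {Q R : Op d} (h : mon 1 1 * Q = mon 1 1 * R) : Q = R := by
  rw [← sub_eq_zero] at h ⊢
  rw [← mul_sub] at h
  set S := Q - R
  obtain ⟨N, hN⟩ := exists_mem_ordLE S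
  have key : ∀ m : ℕ, S ∈ ordLE d (N - m) := by
    intro m
    induction m with
    | zero => simpa using hN
    | succ m ih =>
      intro i hi
      have := congrArg (cf (i + 1)) h
      rwa [cf_D_mul, map_zero, ih (i + 1) (by push_cast at hi; omega), map_zero, zero_add,
        add_sub_cancel_right] at this
  ext i
  exact key (N + 1 - i).toNat i (by omega)

theorem Dinv_mul_assoc (Q R : Op d) : mon 1 (-1) * Q * R = mon 1 (-1) * (Q * R) := by
  apply D_mul_injective
  rw [← D_mul_assoc, D_mul_Dinv_mul, D_mul_Dinv_mul]

theorem func_mul_mon (a b : A) (i : ℤ) : (mon a 0 * mon b i : Op d) = mon (a * b) i := by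
  ext n
  rw [cf_func_mul, cf_mon, cf_mon, mul_ite, mul_zero]

theorem mon_eq_mul (a : A) (i : ℤ) : (mon a i : Op d) = mon a 0 * mon 1 i := by
  rw [func_mul_mon, mul_one]

/-- A subset of the operators that contains functions and `∂^(±1)`, and is closed under
products, contains all `a ∂^i`. -/
theorem mon_induction {p : Op d → Prop} (hf : ∀ a, p (mon a 0)) (hD : p (mon 1 1))
    (hDinv : p (mon 1 (-1))) (hmul : ∀ P Q, p P → p Q → p (P * Q)) (a : A) (i : ℤ) :
    p (mon a i) := by
  have h1 : ∀ i : ℤ, p (mon 1 i) := by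
    intro i
    induction i with
    | zero => exact hf 1
    | succ n ih =>
      rw [← mon_one_mul_mon_one]
      exact hmul _ _ ih hD
    | pred n ih =>
      rw [sub_eq_add_neg, ← mon_one_mul_mon_one]
      exact hmul _ _ ih hDinv
  rw [mon_eq_mul]
  exact hmul _ _ (hf a) (h1 i)

/-- The left factors that associate with everything are closed under products and contain functions
and ∂^(±1), hence all monomials. The order filtration extends this to every left factor. -/
theorem mul_assoc' (P Q R : Op d) : P * Q * R = P * (Q * R) := by
  obtain ⟨M, hM⟩ := exists_mem_ordLE Q
  obtain ⟨N, hN⟩ := exists_mem_ordLE R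
  rw [← sub_eq_zero]
  refine eq_zero_of_mon ((AddMonoidHom.mulRight R).comp (AddMonoidHom.mulRight Q) -
    AddMonoidHom.mulRight (Q * R)) (M + N) ?_ (fun a i => sub_eq_zero.mpr ?_) P
  · intro K S hS
    have := sub_mem (mul_mem_ordLE (mul_mem_ordLE hS hM) hN)
      (ordLE_mono (by omega) (mul_mem_ordLE hS (mul_mem_ordLE hM hN)))
    exact ordLE_mono (by omega) this
  · have := mon_induction (d := d) (p := fun P => ∀ Q R, P * Q * R = P * (Q * R))
      func_mul_assoc D_mul_assoc Dinv_mul_assoc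
      (fun P P' h h' Q R => by rw [h, h, h', h]) a i
    exact this Q R

instance : Ring (Op d) :=
  { (inferInstance : NonUnitalNonAssocRing (Op d)) with
    one := 1
    mul_assoc := mul_assoc'
    one_mul := one_mul'
    mul_one := mul_one' }

theorem mk_pow (L : PDO A) (m : ℕ) : (mk (PDO.pow d L m) : Op d) = mk L ^ m := by
  induction m with
  | zero => rfl
  | succ m ih => rw [_root_.pow_succ, ← ih]; rfl

end Op

end PDO

/-! ### Formal adjoint, derivations acting on coefficients, differential operators -/

namespace PDO

variable {A : Type*} [CommRing A] [Algebra ℚ A]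

namespace Op

variable {d : Derivation ℚ A A}

theorem finite_support_adjoint (P : Op d) (n : ℤ) : (Function.support fun k : ℕ =>
    ((n + k).negOnePow : ℤ) • Ring.choose (n + k) k • (⇑d)^[k] (cf (n + k) P)).Finite := by
  obtain ⟨N, hN⟩ := exists_mem_ordLE P
  refine (Set.finite_Iic (N - n).toNat).subset fun k hk => ?_
  by_contra h
  refine hk ?_
  simp only [Set.mem_Iic, not_le] at h
  simp only
  rw [hN _ (by omega), iterate_map_zero, smul_zero, smul_zero]

/-- The formal adjoint. -/
def adj : Op d →+ Op d where
  toFun P := mk (PDO.adjoint d P)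
  map_zero' := by
    ext n
    refine finsum_eq_zero_of_forall_eq_zero fun k => ?_
    change _ • _ • (⇑d)^[k] (cf (n + k) (0 : Op d)) = 0
    rw [map_zero, iterate_map_zero, smul_zero, smul_zero]
  map_add' P Q := by
    ext n
    rw [map_add]
    refine Eq.trans ?_ (finsum_add_distrib (finite_support_adjoint P n)
      (finite_support_adjoint Q n))
    refine finsum_congr fun k => ?_
    change _ • _ • (⇑d)^[k] (cf (n + k) (P + Q)) = _ • _ • (⇑d)^[k] (cf (n + k) P) +
      _ • _ • (⇑d)^[k] (cf (n + k) Q)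
    rw [map_add, iterate_map_add, smul_add, smul_add]

theorem cf_adj (P : Op d) (n : ℤ) : cf n (adj P) = ∑ᶠ k : ℕ,
    ((n + k).negOnePow : ℤ) • Ring.choose (n + k) k • (⇑d)^[k] (cf (n + k) P) := rfl

theorem adj_mem_ordLE {P : Op d} {N : ℤ} (hP : P ∈ ordLE d N) : adj P ∈ ordLE d N := by
  intro n hn
  rw [cf_adj]
  refine finsum_eq_zero_of_forall_eq_zero fun k => ?_
  rw [hP _ (by omega), iterate_map_zero, smul_zero, smul_zero]

theorem adj_mon (a : A) (i : ℤ) :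
    adj (mon a i : Op d) = (i.negOnePow : ℤ) • (mon 1 i * mon a 0) := by
  ext n
  rw [cf_adj, map_zsmul, cf_mon_mul, smul_finsum' _ (finite_support_of i a n)]
  refine finsum_congr fun k => ?_
  rw [cf_mon, cf_mon]
  by_cases h : n + k = i
  · rw [if_pos h, if_pos (by omega), h, one_mul]
  · rw [if_neg h, if_neg (by omega), iterate_map_zero, mul_zero, smul_zero, smul_zero, smul_zero,
      smul_zero]
where
  finite_support_of (i : ℤ) (a : A) (n : ℤ) : (Function.support fun k : ℕ =>
      Ring.choose i k • ((1 : A) * (⇑d)^[k] (cf (n - i + k) (mon a 0 : Op d)))).Finite := by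
    refine (Set.finite_Iic (i - n).toNat).subset fun k hk => ?_
    by_contra h
    refine hk ?_
    simp only [Set.mem_Iic, not_le] at h
    simp only
    rw [cf_mon, if_neg (by omega), iterate_map_zero, mul_zero, smul_zero]

theorem adj_func_mul (a : A) (Q : Op d) : adj (mon a 0 * Q) = adj Q * mon a 0 := by
  rw [← sub_eq_zero]
  refine eq_zero_of_mon (adj.comp (AddMonoidHom.mulLeft (mon a 0)) -
    (AddMonoidHom.mulRight (mon a 0)).comp adj) 0 (fun N P hP => ?_)
    (fun b j => sub_eq_zero.mpr ?_) Q
  · exact sub_mem (adj_mem_ordLE (ordLE_mono (by omega) (mul_mem_ordLE (mon_mem_ordLE a 0) hP)))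
      (mul_mem_ordLE (adj_mem_ordLE hP) (mon_mem_ordLE a 0))
  · change adj (mon a 0 * mon b j) = adj (mon b j) * mon a 0
    rw [func_mul_mon, adj_mon, adj_mon, smul_mul_assoc, mul_assoc, func_mul_mon, mul_comm a b]

theorem adj_D_mul (Q : Op d) : adj (mon 1 1 * Q) = -(adj Q * mon 1 1) := by
  rw [← add_eq_zero_iff_eq_neg]
  refine eq_zero_of_mon (adj.comp (AddMonoidHom.mulLeft (mon 1 1)) +
    (AddMonoidHom.mulRight (mon 1 1)).comp adj) 1 (fun N P hP => ?_) (fun b j => ?_) Q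
  · exact add_mem (adj_mem_ordLE (ordLE_mono (by omega) (mul_mem_ordLE (mon_mem_ordLE 1 1) hP)))
      (mul_mem_ordLE (adj_mem_ordLE hP) (mon_mem_ordLE 1 1))
  · change adj (mon 1 1 * mon b j) + adj (mon b j) * mon 1 1 = 0
    have h : (mon 1 1 * mon b 0 : Op d) = mon (d b) 0 + mon b 0 * mon 1 1 := by
      rw [D_mul_mon, zero_add, ← mon_eq_mul]
    rw [D_mul_mon, map_add, adj_mon, adj_mon, adj_mon, Int.negOnePow_succ, ← mon_one_mul_mon_one,
      mul_assoc (mon 1 j), h, Units.val_neg, neg_smul, mul_add, smul_add, smul_mul_assoc, mul_assoc]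
    abel

/-- The left factors with this property are closed under products, so functions and ∂^(±1) suffice.
The case of ∂⁻¹ follows from that of ∂ by cancellation. -/
theorem adj_mul (P Q : Op d) : adj (P * Q) = adj Q * adj P := by
  obtain ⟨M, hM⟩ := exists_mem_ordLE Q
  rw [← sub_eq_zero]
  refine eq_zero_of_mon (adj.comp (AddMonoidHom.mulRight Q) -
    (AddMonoidHom.mulLeft (adj Q)).comp adj) M (fun N P hP => ?_)
    (fun a i => sub_eq_zero.mpr ?_) P
  · exact sub_mem (adj_mem_ordLE (mul_mem_ordLE hP hM))
      (ordLE_mono (by omega) (mul_mem_ordLE (adj_mem_ordLE hM) (adj_mem_ordLE hP)))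
  · have hone : adj (1 : Op d) = 1 := by simp [one_def, adj_mon, func_mul_mon]
    have hD : adj (mon 1 1 : Op d) = -mon 1 1 := by
      rw [← mul_one (mon 1 1), adj_D_mul, hone, one_mul, mul_one]
    have hDinv (Q : Op d) : adj (mon 1 (-1) * Q) = -(adj Q * mon 1 (-1)) := by
      conv_rhs => rw [← D_mul_Dinv_mul Q, adj_D_mul, neg_mul, neg_neg, mul_assoc,
        mon_one_mul_mon_one, add_neg_cancel, ← one_def, mul_one]
    refine mon_induction (d := d) (p := fun P => ∀ Q, adj (P * Q) = adj Q * adj P)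
      (fun a Q => ?_) (fun Q => ?_) (fun Q => ?_) (fun P P' h h' Q => ?_) a i Q
    · rw [adj_func_mul, ← mul_one (mon a 0), adj_func_mul, hone, one_mul, mul_one]
    · rw [adj_D_mul, hD, mul_neg]
    · rw [hDinv, ← mul_one (mon 1 (-1)), hDinv 1, hone, one_mul, mul_one, mul_neg]
    · rw [mul_assoc, h, h', h, mul_assoc]

/-- The terms with positive index carry a binomial coefficient (k choose k + 1) = 0, so a residue
receives no derivative corrections. -/
theorem cf_neg_one_adj (P : Op d) : cf (-1) (adj P) = -cf (-1) P := by
  rw [cf_adj, finsum_eq_single _ 0]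
  · simp
  · intro k hk
    obtain ⟨k, rfl⟩ := Nat.exists_eq_succ_of_ne_zero hk
    have : Ring.choose (-1 + ((k + 1 : ℕ) : ℤ)) (k + 1) = 0 := by
      rw [show -1 + ((k + 1 : ℕ) : ℤ) = (k : ℕ) by push_cast; ring, Ring.choose_natCast,
        Nat.choose_eq_zero_of_lt (by omega), Nat.cast_zero]
    rw [Nat.succ_eq_add_one, this, zero_smul, smul_zero]

/-- If `L* = -∂ L ∂⁻¹`, then the odd powers of `L` annihilate constants. -/
theorem cf_zero_pow {L : Op d} (hL : adj L = -(mon 1 1 * L * mon 1 (-1))) {m : ℕ} (hm : Odd m) :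
    cf 0 (L ^ m) = 0 := by
  have h1 : ∀ m, adj (L ^ m) = (-1) ^ m * (mon 1 1 * L ^ m * mon 1 (-1)) := by
    intro m
    induction m with
    | zero => simp [one_def, adj_mon, func_mul_mon, mon_one_mul_mon_one]
    | succ m ih =>
      have h : (mon 1 (-1) : Op d) * mon 1 1 = 1 := by
        rw [mon_one_mul_mon_one, neg_add_cancel, one_def]
      rw [pow_succ', adj_mul, ih, hL, pow_succ (-1 : Op d)]
      simp only [mul_assoc, mul_neg, neg_mul, one_mul]
      rw [← mul_assoc (mon 1 (-1)) (mon 1 1), h, one_mul, ← mul_assoc (L ^ m), ← pow_succ,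
        pow_succ', mul_assoc]
  -- For odd m the constraint makes L^m ∂⁻¹ self-adjoint, so its residue, which is the constant
  -- coefficient of L^m, equals its own negative.
  have h2 : adj (L ^ m * mon 1 (-1)) = L ^ m * mon 1 (-1) := by
    have h3 : adj (mon 1 (-1) : Op d) = -mon 1 (-1) := by
      simp [adj_mon, ← one_def]
    rw [adj_mul, h1, h3, hm.neg_one_pow, neg_one_mul, neg_mul_neg, mul_assoc, ← mul_assoc,
      ← mul_assoc, mon_one_mul_mon_one, neg_add_cancel, ← one_def, one_mul]
  have h4 := cf_neg_one_adj (L ^ m * mon 1 (-1))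
  rw [h2, cf_mul_mon_one, sub_self] at h4
  have h5 : (2 : ℚ) • cf 0 (L ^ m) = 0 := by
    rw [two_smul]
    exact add_eq_zero_iff_eq_neg.mpr h4
  simpa using congrArg ((2 : ℚ)⁻¹ • ·) h5

/-- The coefficientwise action of a linear map. -/
def mapCoeff (δ : A →ₗ[ℚ] A) : Op d →ₗ[ℚ] Op d where
  toFun P := mk ⟨fun i => δ (cf i P), by
    obtain ⟨N, hN⟩ := exists_mem_ordLE P
    exact ⟨N, fun i hi => by rw [hN i hi, map_zero]⟩⟩
  map_add' P Q := ext fun i => map_add δ (cf i P) (cf i Q)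
  map_smul' c P := ext fun i => map_smul δ c (cf i P)

@[simp] theorem cf_mapCoeff (δ : A →ₗ[ℚ] A) (P : Op d) (i : ℤ) :
    cf i (mapCoeff δ P) = δ (cf i P) := rfl

theorem mapCoeff_mul (δ : Derivation ℚ A A) (hδ : ∀ f, δ (d f) = d (δ f)) (P Q : Op d) :
    mapCoeff (δ : A →ₗ[ℚ] A) (P * Q) = mapCoeff (δ : A →ₗ[ℚ] A) P * Q
      + P * mapCoeff (δ : A →ₗ[ℚ] A) Q := by
  ext n
  rw [map_add, cf_mapCoeff, cf_mul, cf_mul, cf_mul,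
    ← finsum_add_distrib (finite_support_mul _ Q n) (finite_support_mul P _ n)]
  refine ((δ : A →ₗ[ℚ] A).toAddMonoidHom.map_finsum (finite_support_mul P Q n)).trans ?_
  refine finsum_congr fun p => ?_
  have h : ∀ k f, δ ((⇑d)^[k] f) = (⇑d)^[k] (δ f) := fun k f =>
    (Function.Commute.iterate_right (f := ⇑δ) (g := ⇑d) hδ k) f
  simp [h, mul_comm, mul_add, add_comm]

theorem mapCoeff_mon (δ : A →ₗ[ℚ] A) (a : A) (i : ℤ) :
    mapCoeff δ (mon a i : Op d) = mon (δ a) i := by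
  ext n
  rw [cf_mapCoeff, cf_mon, cf_mon, apply_ite δ, map_zero]

/-- Differential operators. -/
def diffOps (d : Derivation ℚ A A) : Submodule ℚ (Op d) where
  carrier := {P | ∀ i, i < 0 → cf i P = 0}
  add_mem' hP hQ i hi := by rw [map_add, hP i hi, hQ i hi, add_zero]
  zero_mem' i _ := map_zero _
  smul_mem' c P hP i hi := by rw [map_smul, hP i hi, smul_zero]

theorem mul_mem_diffOps {P Q : Op d} (hP : P ∈ diffOps d) (hQ : Q ∈ diffOps d) :
    P * Q ∈ diffOps d := by
  intro n hn
  rw [cf_mul]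
  refine finsum_eq_zero_of_forall_eq_zero fun p => ?_
  rcases lt_or_ge p.1 0 with hp | hp
  · rw [hP _ hp, zero_mul, smul_zero]
  · lift p.1 to ℕ using hp with i
    rcases lt_or_ge i p.2 with h | h
    · rw [Ring.choose_natCast, Nat.choose_eq_zero_of_lt h, Nat.cast_zero, zero_smul]
    · rw [hQ _ (by omega), iterate_map_zero, mul_zero, smul_zero]

theorem mon_mem_diffOps (a : A) {i : ℤ} (hi : 0 ≤ i) : (mon a i : Op d) ∈ diffOps d := by
  intro n hn
  rw [cf_mon, if_neg (by omega)]

theorem one_mem_diffOps : (1 : Op d) ∈ diffOps d := mon_mem_diffOps 1 le_rfl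

theorem mapCoeff_mem_diffOps (δ : A →ₗ[ℚ] A) {P : Op d} (hP : P ∈ diffOps d) :
    mapCoeff δ P ∈ diffOps d := fun i hi => by rw [cf_mapCoeff, hP i hi, map_zero]

theorem mapCoeff_mem_ordLE (δ : A →ₗ[ℚ] A) {P : Op d} {N : ℤ} (hP : P ∈ ordLE d N) :
    mapCoeff δ P ∈ ordLE d N := fun i hi => by rw [cf_mapCoeff, hP i hi, map_zero]

/-- The action of an operator on a function is the constant coefficient of its product with the
operator of multiplication by this function. -/
theorem cf_zero_mul_func (P : Op d) (f : A) : cf 0 (P * mon f 0) = PDO.apply d P f := by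
  rw [cf_mul]
  have h : (Function.support fun p : ℤ × ℕ => Ring.choose p.1 p.2 •
      (cf p.1 P * (⇑d)^[p.2] (cf (0 - p.1 + p.2) (mon f 0 : Op d)))) ⊆
      Set.range fun k : ℕ => ((k, k) : ℤ × ℕ) := by
    rintro ⟨i, k⟩ hp
    refine ⟨k, ?_⟩
    by_contra h
    refine hp ?_
    simp only [Prod.mk.injEq, and_true] at h
    simp only
    rw [cf_mon, if_neg (by omega), iterate_map_zero, mul_zero, smul_zero]
  rw [← Set.indicator_eq_self.mpr h, ← finsum_mem_def,
    finsum_mem_range fun k l h => (Prod.mk.inj h).2]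
  refine finsum_congr fun k => ?_
  rw [Ring.choose_natCast, Nat.choose_self, Nat.cast_one, one_smul, cf_mon, if_pos (by omega)]
  rfl

/-- The constant coefficient is the value at 1. Since N - N(1) is a differential operator times ∂ on
the right, M (N - N(1)) kills constants. -/
theorem cf_zero_mul_of_diffOps {M N : Op d} (hM : M ∈ diffOps d) (hN : N ∈ diffOps d) :
    cf 0 (M * N) = cf 0 (M * mon (cf 0 N) 0) := by
  have h : (N - mon (cf 0 N) 0) * mon 1 (-1) ∈ diffOps d := by
    intro i hi
    rw [cf_mul_mon_one, map_sub, cf_mon]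
    split_ifs with h
    · rw [h, sub_self]
    · rw [hN _ (by omega), sub_zero]
  have h1 : M * N - M * mon (cf 0 N) 0 =
      M * ((N - mon (cf 0 N) 0) * mon 1 (-1)) * mon 1 1 := by
    rw [mul_assoc, mul_assoc, mon_one_mul_mon_one, neg_add_cancel, ← one_def, mul_one, mul_sub]
  rw [← sub_eq_zero, ← map_sub, h1, cf_mul_mon_one]
  exact mul_mem_diffOps hM h _ (by norm_num)

/-- Functions as operators. -/
def func (d : Derivation ℚ A A) : A →+* Op d where
  toFun a := mon a 0
  map_one' := rfl
  map_mul' a b := (func_mul_mon a b 0).symm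
  map_zero' := ext fun i => by rw [cf_mon, ite_self, map_zero]
  map_add' a b := ext fun i => by rw [map_add, cf_mon, cf_mon, cf_mon]; split_ifs <;> simp

theorem func_apply (a : A) : func d a = mon a 0 := rfl

end Op

end PDO

/-! ### Convolution sums and recursions -/

section Sums

variable {M : Type*} [AddCommMonoid M]

theorem sum_antidiagonal_assoc (f : ℕ → ℕ → ℕ → M) (n : ℕ) :
    ∑ p ∈ antidiagonal n, ∑ q ∈ antidiagonal p.1, f q.1 q.2 p.2 =
      ∑ p ∈ antidiagonal n, ∑ q ∈ antidiagonal p.2, f p.1 q.1 q.2 := by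
  simp only [Finset.sum_sigma']
  apply Finset.sum_nbij' (fun ⟨⟨_, j⟩, ⟨k, l⟩⟩ => ⟨(k, l + j), (l, j)⟩)
    (fun ⟨⟨i, _⟩, ⟨k, l⟩⟩ => ⟨(i + k, l), (i, k)⟩)
  · rintro ⟨⟨a, b⟩, ⟨c, e⟩⟩
    simp only [Finset.mem_sigma, mem_antidiagonal]
    rintro ⟨h, h'⟩
    exact ⟨by omega, trivial⟩
  · rintro ⟨⟨a, b⟩, ⟨c, e⟩⟩
    simp only [Finset.mem_sigma, mem_antidiagonal]
    rintro ⟨h, h'⟩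
    exact ⟨by omega, trivial⟩
  · rintro ⟨⟨a, b⟩, ⟨c, e⟩⟩
    simp only [Finset.mem_sigma, mem_antidiagonal]
    rintro ⟨-, rfl⟩
    rfl
  · rintro ⟨⟨a, b⟩, ⟨c, e⟩⟩
    simp only [Finset.mem_sigma, mem_antidiagonal]
    rintro ⟨-, rfl⟩
    rfl
  · rintro ⟨⟨a, b⟩, ⟨c, e⟩⟩ -
    rfl

theorem sum_antidiagonal_left_comm (f : ℕ → ℕ → ℕ → M) (n : ℕ) :
    ∑ p ∈ antidiagonal n, ∑ q ∈ antidiagonal p.2, f p.1 q.1 q.2 =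
      ∑ p ∈ antidiagonal n, ∑ q ∈ antidiagonal p.2, f q.1 p.1 q.2 := by
  rw [← sum_antidiagonal_assoc, ← sum_antidiagonal_assoc (fun i a b => f a i b)]
  refine Finset.sum_congr rfl fun p _ => ?_
  rw [← Finset.Nat.sum_antidiagonal_swap]
  rfl

end Sums

section Recursion

variable {M : Type*} [AddCommGroup M] [Module ℚ M]

/-- As `T 0 = 0`, the right side involves only earlier terms, and division by n is possible over ℚ.
-/
theorem exists_antidiagonal_recursion (T : ℕ → M →+ M) (hT : T 0 = 0) (m : M) :
    ∃ F : ℕ → M, F 0 = m ∧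
      ∀ n, n • F n = ∑ p ∈ antidiagonal n, T p.1 (F p.2) := by
  let F : ℕ → M := fun n => Nat.strongRec (motive := fun _ => M) (fun n ih =>
    if n = 0 then m else (n : ℚ)⁻¹ • ∑ p ∈ antidiagonal n,
      if h : p.2 < n then T p.1 (ih p.2 h) else 0) n
  have hF : ∀ n, F n = if n = 0 then m else (n : ℚ)⁻¹ • ∑ p ∈ antidiagonal n,
      if p.2 < n then T p.1 (F p.2) else 0 := by
    intro n
    simp only [F]
    rw [Nat.strongRec_eq]
    simp
  refine ⟨F, by rw [hF, if_pos rfl], fun n => ?_⟩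
  rcases eq_or_ne n 0 with rfl | hn
  · simp [hT]
  · rw [hF n, if_neg hn, ← Nat.cast_smul_eq_nsmul ℚ, smul_smul,
      mul_inv_cancel₀ (by exact_mod_cast hn), one_smul]
    refine Finset.sum_congr rfl fun p hp => ?_
    split_ifs with h
    · rfl
    · have : p.1 = 0 := by
        have := mem_antidiagonal.mp hp
        omega
      rw [this, hT, AddMonoidHom.zero_apply]

/-- Every invariance statement about solutions of evolution equations rests on this: a subspace
stable under the recursion traps its solutions, even with an error term in the subspace. The zero
subspace gives uniqueness. -/
theorem mem_of_antidiagonal_recursion (T : ℕ → M →+ M) (hT : T 0 = 0) (N : Submodule ℚ M)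
    (hN : ∀ k, ∀ x ∈ N, T k x ∈ N) (F : ℕ → M) (h0 : F 0 ∈ N)
    (hF : ∀ n, n • F n - ∑ p ∈ antidiagonal n, T p.1 (F p.2) ∈ N) (n : ℕ) : F n ∈ N := by
  induction n using Nat.strong_induction_on with
  | _ n ih =>
    rcases eq_or_ne n 0 with rfl | hn
    · exact h0
    · have h1 : ∑ p ∈ antidiagonal n, T p.1 (F p.2) ∈ N := by
        refine Submodule.sum_mem _ fun p hp => ?_
        have := mem_antidiagonal.mp hp
        rcases eq_or_ne p.1 0 with h | h
        · rw [h, hT]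
          exact N.zero_mem
        · exact hN _ _ (ih _ (by omega))
      have h2 := N.add_mem (hF n) h1
      rw [sub_add_cancel, ← Nat.cast_smul_eq_nsmul ℚ] at h2
      have h3 := N.smul_mem (n : ℚ)⁻¹ h2
      rwa [smul_smul, inv_mul_cancel₀ (by exact_mod_cast hn), one_smul] at h3

end Recursion

/-! ### The Euler operator and the evolution operator on power series -/

namespace PowerSeries

section Ring

variable {S : Type*} [Ring S]

/-- The Euler operator `X d/dX`. -/
def euler : S⟦X⟧ →+ S⟦X⟧ where
  toFun F := mk fun n => n • coeff n F
  map_zero' := by ext n; simp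
  map_add' F G := by ext n; simp

theorem coeff_euler (F : S⟦X⟧) (n : ℕ) : coeff n (euler F) = n • coeff n F := by
  simp [euler]

theorem euler_mul (F G : S⟦X⟧) : euler (F * G) = euler F * G + F * euler G := by
  ext n
  rw [coeff_euler, map_add, coeff_mul, coeff_mul, coeff_mul, Finset.smul_sum,
    ← Finset.sum_add_distrib]
  refine Finset.sum_congr rfl fun p hp => ?_
  rw [coeff_euler, coeff_euler, ← mem_antidiagonal.mp hp, add_smul, smul_mul_assoc,
    mul_smul_comm]

/-- The operator `∑ k, X^k Δ_k`, acting on coefficients. -/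
def flow (Δ : ℕ → S →+ S) : S⟦X⟧ →+ S⟦X⟧ where
  toFun F := mk fun n => ∑ p ∈ antidiagonal n, Δ p.1 (coeff p.2 F)
  map_zero' := by ext n; simp
  map_add' F G := by ext n; simp [Finset.sum_add_distrib]

theorem coeff_flow (Δ : ℕ → S →+ S) (F : S⟦X⟧) (n : ℕ) :
    coeff n (flow Δ F) = ∑ p ∈ antidiagonal n, Δ p.1 (coeff p.2 F) := by
  simp [flow]

theorem flow_mul (Δ : ℕ → S →+ S) (hΔ : ∀ k a b, Δ k (a * b) = Δ k a * b + a * Δ k b)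
    (F G : S⟦X⟧) : flow Δ (F * G) = flow Δ F * G + F * flow Δ G := by
  ext n
  rw [coeff_flow, map_add, coeff_mul, coeff_mul]
  simp only [coeff_flow, coeff_mul, map_sum, hΔ, Finset.sum_add_distrib, Finset.sum_mul,
    Finset.mul_sum]
  rw [sum_antidiagonal_assoc (fun i a b => Δ i (coeff a F) * coeff b G),
    sum_antidiagonal_left_comm (fun i a b => coeff a F * Δ i (coeff b G))]

/-- The operator `X d/dX - 2 ∑ k, X^k Δ_k`. -/
def evol (Δ : ℕ → S →+ S) : S⟦X⟧ →+ S⟦X⟧ := euler - 2 • flow Δ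

theorem evol_apply (Δ : ℕ → S →+ S) (F : S⟦X⟧) : evol Δ F = euler F - 2 • flow Δ F := rfl

theorem coeff_evol (Δ : ℕ → S →+ S) (F : S⟦X⟧) (n : ℕ) : coeff n (evol Δ F) =
    n • coeff n F - 2 • ∑ p ∈ antidiagonal n, Δ p.1 (coeff p.2 F) := by
  rw [evol_apply, map_sub, map_nsmul, coeff_euler, coeff_flow]

theorem evol_mul (Δ : ℕ → S →+ S) (hΔ : ∀ k a b, Δ k (a * b) = Δ k a * b + a * Δ k b)
    (F G : S⟦X⟧) : evol Δ (F * G) = evol Δ F * G + F * evol Δ G := by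
  rw [evol_apply, evol_apply, evol_apply, euler_mul, flow_mul Δ hΔ, sub_mul, mul_sub, smul_add,
    smul_mul_assoc, mul_smul_comm]
  abel

theorem euler_pow_of_commute {F : S⟦X⟧} (h : Commute (euler F) F) (m : ℕ) :
    euler (F ^ (m + 1)) = (m + 1) • (euler F * F ^ m) := by
  induction m with
  | zero => simp
  | succ m ih =>
    rw [pow_succ, euler_mul, ih, smul_mul_assoc, mul_assoc, ← pow_succ,
      ← (h.pow_right (m + 1)).eq, add_smul (m + 1) 1, one_smul]

theorem coeff_pow_eq_zero_of_lt {F : S⟦X⟧} (h : coeff 0 F = 0) {m k : ℕ} (hk : k < m) :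
    coeff k (F ^ m) = 0 := by
  induction m generalizing k with
  | zero => omega
  | succ m ih =>
    rw [pow_succ, coeff_mul]
    refine Finset.sum_eq_zero fun p hp => ?_
    have := mem_antidiagonal.mp hp
    rcases lt_or_ge p.1 m with h' | h'
    · rw [ih h', zero_mul]
    · rw [show p.2 = 0 by omega, h, mul_zero]

variable [Module ℚ S]

/-- Power series with coefficients in a given submodule. -/
def coeffsIn (N : Submodule ℚ S) : AddSubgroup S⟦X⟧ where
  carrier := {F | ∀ n, coeff n F ∈ N}
  add_mem' hF hG n := by rw [map_add]; exact N.add_mem (hF n) (hG n)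
  zero_mem' n := by rw [map_zero]; exact N.zero_mem
  neg_mem' hF n := by rw [map_neg]; exact N.neg_mem (hF n)

theorem mul_mem_coeffsIn {N N' N'' : Submodule ℚ S} (h : ∀ a ∈ N, ∀ b ∈ N', a * b ∈ N'')
    {F G : S⟦X⟧} (hF : F ∈ coeffsIn N) (hG : G ∈ coeffsIn N') : F * G ∈ coeffsIn N'' := by
  intro n
  rw [coeff_mul]
  exact Submodule.sum_mem _ fun p _ => h _ (hF _) _ (hG _)

theorem C_mem_coeffsIn {N : Submodule ℚ S} {a : S} (h : a ∈ N) : C a ∈ coeffsIn N := by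
  intro n
  rw [coeff_C]
  split_ifs
  exacts [h, N.zero_mem]

theorem X_mul_mem_coeffsIn {N : Submodule ℚ S} {F : S⟦X⟧} (h : F ∈ coeffsIn N) :
    X * F ∈ coeffsIn N := by
  intro n
  rcases n with _ | n
  · rw [coeff_zero_X_mul]
    exact N.zero_mem
  · rw [coeff_succ_X_mul]
    exact h n

theorem mem_coeffsIn_of_evol (Δ : ℕ → S →+ S) (hΔ0 : Δ 0 = 0) (N : Submodule ℚ S)
    (hN : ∀ k, ∀ x ∈ N, Δ k x ∈ N) {F : S⟦X⟧} (h0 : coeff 0 F ∈ N)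
    (hF : evol Δ F ∈ coeffsIn N) : F ∈ coeffsIn N := by
  refine mem_of_antidiagonal_recursion (fun k => 2 • Δ k) (by simp [hΔ0]) N
    (fun k x hx => N.smul_of_tower_mem 2 (hN k x hx)) (fun n => coeff n F) h0 fun n => ?_
  have := hF n
  rwa [coeff_evol, Finset.smul_sum] at this

theorem eq_zero_of_evol (Δ : ℕ → S →+ S) (hΔ0 : Δ 0 = 0) {F : S⟦X⟧} (h0 : coeff 0 F = 0)
    (hF : evol Δ F = 0) : F = 0 := by
  ext n
  have := mem_coeffsIn_of_evol Δ hΔ0 ⊥ (fun k x hx => by simp_all) (F := F) (by simp [h0])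
    (by rw [hF]; exact zero_mem _) n
  simpa using this

end Ring

end PowerSeries

/-! ### The shift as solution of an evolution equation -/

namespace BKP

variable {A : Type*} [CommRing A] [Algebra ℚ A]

/-- The derivation `∂/∂t_k` for odd `k`, and zero for even `k`. -/
def oddD (D : ℕ → Derivation ℚ A A) (k : ℕ) : A →ₗ[ℚ] A :=
  if Odd k then (D (k / 2) : A →ₗ[ℚ] A) else 0

theorem oddD_zero (D : ℕ → Derivation ℚ A A) : oddD D 0 = 0 := by simp [oddD]

theorem oddD_mul (D : ℕ → Derivation ℚ A A) (k : ℕ) (a b : A) :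
    oddD D k (a * b) = oddD D k a * b + a * oddD D k b := by
  unfold oddD
  split_ifs
  · simp [mul_comm, add_comm]
  · simp

/-- The operator `X d/dX - 2 ∑ X^(2n+1) ∂/∂t_(2n+1)` on power series. -/
def evolA (D : ℕ → Derivation ℚ A A) : A⟦X⟧ →+ A⟦X⟧ := evol fun k => (oddD D k).toAddMonoidHom

theorem euler_shiftField (D : ℕ → Derivation ℚ A A) (c : ℚ) :
    euler (shiftField D c) = PowerSeries.mk fun k => c • (oddD D k : Module.End ℚ A) := by
  ext1 k
  rw [coeff_euler, shiftField, coeff_mk, coeff_mk, oddD]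
  split_ifs with h
  · have : (k : ℚ) ≠ 0 := by exact_mod_cast h.pos.ne'
    rw [← Nat.cast_smul_eq_nsmul ℚ, smul_smul, mul_div_cancel₀ _ this]
  · rw [smul_zero, smul_zero]

theorem commute_euler_shiftField (D : ℕ → Derivation ℚ A A)
    (hD : ∀ (m n : ℕ) (f : A), D m (D n f) = D n (D m f)) (c : ℚ) :
    Commute (euler (shiftField D c)) (shiftField D c) := by
  have h : ∀ i j, Commute (coeff i (shiftField D c)) (coeff j (shiftField D c)) := by
    intro i j
    simp only [shiftField, coeff_mk]
    split_ifs
    · refine (Commute.smul_left (Commute.smul_right ?_ _) _)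
      exact LinearMap.ext fun f => hD _ _ f
    · exact Commute.zero_right _
    · exact Commute.zero_left _
    · exact Commute.zero_left _
  change _ * _ = _ * _
  ext1 n
  rw [coeff_mul, coeff_mul, ← Finset.Nat.sum_antidiagonal_swap]
  refine Finset.sum_congr rfl fun p _ => ?_
  rw [coeff_euler, coeff_euler]
  exact ((h _ _).smul_left _).eq

theorem shift_coeff_of_le (D : ℕ → Derivation ℚ A A) (c : ℚ) (f : A) {k N : ℕ} (h : k < N) :
    coeff k (shift D c f) = ∑ m ∈ Finset.range N,
      ((m.factorial : ℚ)⁻¹) • (coeff k (shiftField D c ^ m)) f := by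
  rw [shift, coeff_mk]
  refine Finset.sum_subset (Finset.range_mono h) fun m _ hm => ?_
  rw [coeff_pow_eq_zero_of_lt (by simp [shiftField]) (by simpa using hm), LinearMap.zero_apply,
    smul_zero]

theorem coeff_zero_shift (D : ℕ → Derivation ℚ A A) (c : ℚ) (f : A) :
    coeff 0 (shift D c f) = f := by
  simp [shift]

/-- This is the differential equation X d/dX exp(G) = (X d/dX G) exp(G), coefficient by coefficient.
It holds because G commutes with its Euler derivative, and the Euler operator cancels the factors
1/(2n+1) in G. -/
theorem smul_coeff_shift (D : ℕ → Derivation ℚ A A)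
    (hD : ∀ (m n : ℕ) (f : A), D m (D n f) = D n (D m f)) (c : ℚ) (f : A) (n : ℕ) :
    n • coeff n (shift D c f) =
      c • ∑ p ∈ antidiagonal n, oddD D p.1 (coeff p.2 (shift D c f)) := by
  have h1 : ∀ m, n • (coeff n (shiftField D c ^ (m + 1))) f = (m + 1) • c •
      ∑ p ∈ antidiagonal n, oddD D p.1 ((coeff p.2 (shiftField D c ^ m)) f) := by
    intro m
    have := congrArg (fun F => (coeff n F) f)
      (euler_pow_of_commute (commute_euler_shiftField D hD c) m)
    simp only [coeff_euler, euler_shiftField, map_nsmul, coeff_mul, coeff_mk] at this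
    refine Eq.trans ?_ (this.trans ?_)
    · rfl
    · rw [LinearMap.smul_apply, LinearMap.sum_apply, Finset.smul_sum (r := c)]
      rfl
  rw [shift_coeff_of_le D c f (Nat.lt_succ_self n), Finset.sum_range_succ']
  have h0 : n • ((((Nat.factorial 0 : ℕ) : ℚ)⁻¹) • (coeff n (shiftField D c ^ 0) :
      Module.End ℚ A) f) = 0 := by
    rcases n with _ | n
    · simp
    · simp [coeff_one]
  rw [smul_add, h0, add_zero, Finset.smul_sum]
  have h2 : ∀ m ∈ Finset.range n, n • ((((m + 1).factorial : ℕ) : ℚ)⁻¹ •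
      (coeff n (shiftField D c ^ (m + 1))) f) = c • ∑ p ∈ antidiagonal n,
        oddD D p.1 (((m.factorial : ℚ)⁻¹) • (coeff p.2 (shiftField D c ^ m)) f) := by
    intro m _
    have : (m.factorial : ℚ) ≠ 0 := by exact_mod_cast m.factorial_ne_zero
    rw [smul_comm, h1, ← Nat.cast_smul_eq_nsmul ℚ, smul_smul, smul_comm _ c]
    simp only [map_smul]
    rw [← Finset.smul_sum]
    congr 2
    rw [Nat.factorial_succ]
    push_cast
    field_simp
  rw [Finset.sum_congr rfl h2, ← Finset.smul_sum, Finset.sum_comm]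
  congr 1
  refine Finset.sum_congr rfl fun p hp => ?_
  rw [← map_sum]
  -- For `p.1 = 0` the truncated exponential sum need not be the coefficient of the shift, but `oddD
  -- D 0 = 0` discards that term.
  rcases eq_or_ne p.1 0 with h | h
  · rw [h, oddD_zero, LinearMap.zero_apply, LinearMap.zero_apply]
  · have := mem_antidiagonal.mp hp
    rw [shift_coeff_of_le D c f (show p.2 < n by omega)]

theorem evolA_shift (D : ℕ → Derivation ℚ A A)
    (hD : ∀ (m n : ℕ) (f : A), D m (D n f) = D n (D m f)) (f : A) :
    evolA D (shift D 2 f) = 0 := by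
  ext n
  rw [evolA, coeff_evol, smul_coeff_shift D hD, map_zero, sub_eq_zero, two_smul, two_smul]
  rfl

/-- Only odd powers of X occur in the exponent, so X ↦ -X changes its sign. -/
theorem rescale_shift (D : ℕ → Derivation ℚ A A) (c : ℚ) (f : A) :
    rescale (-1 : A) (shift D c f) = shift D (-c) f := by
  have h : ∀ m k, coeff k (shiftField D (-c) ^ m) =
      (-1 : ℚ) ^ k • coeff k (shiftField D c ^ m) := by
    intro m
    induction m with
    | zero =>
      intro k
      rw [pow_zero, pow_zero, coeff_one]
      split_ifs with h
      · simp [h]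
      · simp
    | succ m ih =>
      intro k
      rw [pow_succ, pow_succ, coeff_mul, coeff_mul, Finset.smul_sum]
      refine Finset.sum_congr rfl fun p hp => ?_
      have h1 : coeff p.2 (shiftField D (-c)) = (-1 : ℚ) ^ p.2 • coeff p.2 (shiftField D c) := by
        rw [shiftField, shiftField, coeff_mk, coeff_mk]
        split_ifs with h
        · rw [h.neg_one_pow, smul_smul]
          congr 1
          ring
        · simp
      rw [ih, h1, smul_mul_smul_comm, ← pow_add, mem_antidiagonal.mp hp]
  ext k
  rw [coeff_rescale, shift, shift, coeff_mk, coeff_mk, Finset.mul_sum]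
  refine Finset.sum_congr rfl fun m _ => ?_
  rw [h, LinearMap.smul_apply, smul_comm _ ((-1 : ℚ) ^ k), mul_smul_comm]
  rcases Nat.even_or_odd k with hk | hk
  · rw [hk.neg_one_pow, hk.neg_one_pow, one_mul, one_smul]
  · rw [hk.neg_one_pow, hk.neg_one_pow, neg_one_mul, neg_one_smul, smul_neg]

end BKP

/-! ### Geometric series and linear evolution equations -/

namespace PowerSeries

variable {S : Type*} [Ring S]

theorem euler_C (a : S) : euler (C a) = 0 := by
  ext n
  rw [coeff_euler, coeff_C, map_zero]
  split_ifs with h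
  · rw [h, zero_smul]
  · rw [smul_zero]

theorem flow_C (Δ : ℕ → S →+ S) (a : S) : flow Δ (C a) = mk fun n => Δ n a := by
  ext n
  rw [coeff_flow, coeff_mk, Finset.sum_eq_single (n, 0)]
  · simp
  · rintro ⟨i, j⟩ hp h
    rw [coeff_C, if_neg, map_zero]
    rintro rfl
    exact h (by simpa using mem_antidiagonal.mp hp)
  · intro h
    exact absurd (by simp) h

theorem evol_C (Δ : ℕ → S →+ S) (a : S) : evol Δ (C a) = -(2 • mk fun n => Δ n a) := by
  rw [evol_apply, euler_C, flow_C, zero_sub]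

theorem evol_X (Δ : ℕ → S →+ S) (hΔ : ∀ k, Δ k 1 = 0) : evol Δ X = X := by
  ext n
  rw [coeff_evol, coeff_X, Finset.sum_eq_zero, smul_zero, sub_zero]
  · split_ifs with h
    · rw [h, one_smul]
    · rw [smul_zero]
  · intro p _
    rw [coeff_X]
    split_ifs
    · exact hΔ _
    · exact map_zero _

/-- The geometric series `∑ k, a^k X^k`. -/
def geom (a : S) : S⟦X⟧ := mk fun k => a ^ k

theorem geom_mul (a : S) : geom a * (1 - C a * X) = 1 := by
  ext n
  rw [mul_sub, mul_one, ← mul_assoc, map_sub]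
  rcases n with _ | n
  · simp [geom]
  · rw [coeff_succ_mul_X, coeff_mul_C, geom, coeff_mk, coeff_mk, pow_succ, sub_self, coeff_one,
      if_neg (by omega)]

theorem mul_geom (a : S) : (1 - C a * X) * geom a = 1 := by
  ext n
  rw [sub_mul, one_mul, mul_assoc, map_sub]
  rcases n with _ | n
  · simp [geom]
  · rw [coeff_C_mul, coeff_succ_X_mul, geom, coeff_mk, coeff_mk, pow_succ', sub_self, coeff_one,
      if_neg (by omega)]

variable [Module ℚ S]

theorem exists_evol_eq_mul (Δ : ℕ → S →+ S) (hΔ0 : Δ 0 = 0) (G : S⟦X⟧) (hG : coeff 0 G = 0)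
    (m : S) : ∃ F : S⟦X⟧, coeff 0 F = m ∧ evol Δ F = F * G := by
  obtain ⟨F, h0, hF⟩ := exists_antidiagonal_recursion
    (fun k => 2 • Δ k + AddMonoidHom.mulRight (coeff k G)) (by ext; simp [hΔ0, hG]) m
  refine ⟨mk F, by simpa using h0, ?_⟩
  ext n
  rw [coeff_evol, coeff_mk, hF, coeff_mul, ← Finset.Nat.sum_antidiagonal_swap (n := n)
    (f := fun p => coeff p.1 (mk F) * coeff p.2 G), Finset.smul_sum, ← Finset.sum_sub_distrib]
  refine Finset.sum_congr rfl fun p _ => ?_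
  simp

theorem mem_coeffsIn_of_evol_mul (Δ : ℕ → S →+ S) (hΔ0 : Δ 0 = 0) (N : Submodule ℚ S)
    (hN : ∀ k, ∀ x ∈ N, Δ k x ∈ N) {F G : S⟦X⟧} (hG : coeff 0 G = 0)
    (hGN : ∀ k, ∀ x ∈ N, x * coeff k G ∈ N) (h0 : coeff 0 F ∈ N)
    (hF : evol Δ F - F * G ∈ coeffsIn N) : F ∈ coeffsIn N := by
  refine mem_of_antidiagonal_recursion
    (fun k => 2 • Δ k + AddMonoidHom.mulRight (coeff k G)) (by ext; simp [hΔ0, hG]) N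
    (fun k x hx => N.add_mem (N.smul_of_tower_mem 2 (hN k x hx)) (hGN k x hx))
    (fun n => coeff n F) h0 fun n => ?_
  have := hF n
  rw [map_sub, coeff_evol, coeff_mul, ← Finset.Nat.sum_antidiagonal_swap (n := n)
    (f := fun p => coeff p.1 F * coeff p.2 G), Finset.smul_sum, sub_sub,
    ← Finset.sum_add_distrib] at this
  exact this

theorem mem_coeffsIn_of_two_nsmul {N : Submodule ℚ S} {F : S⟦X⟧} (h : 2 • F ∈ coeffsIn N) :
    F ∈ coeffsIn N := by
  intro n
  have h1 := h n
  rw [map_nsmul] at h1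
  have h2 := N.smul_mem (2 : ℚ)⁻¹ h1
  rwa [← Nat.cast_smul_eq_nsmul ℚ, smul_smul, Nat.cast_ofNat, inv_mul_cancel₀ two_ne_zero,
    one_smul] at h2

end PowerSeries

/-! ### Power series with operator coefficients -/

namespace OpSeries

open PDO (Op)
open PDO.Op

variable {A : Type*} [CommRing A] [Algebra ℚ A] {d : Derivation ℚ A A}

/-- The coefficient of `∂^i` in a power series of operators. -/
def cfs (i : ℤ) : (Op d)⟦X⟧ →+ A⟦X⟧ where
  toFun M := PowerSeries.mk fun n => cf i (coeff n M)
  map_zero' := by ext n; simp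
  map_add' M N := by ext n; simp

@[simp] theorem coeff_cfs (i : ℤ) (M : (Op d)⟦X⟧) (n : ℕ) :
    coeff n (cfs i M) = cf i (coeff n M) := by
  simp [cfs]

/-- Power series of functions as power series of operators. -/
def funcs (d : Derivation ℚ A A) : A⟦X⟧ →+* (Op d)⟦X⟧ := PowerSeries.map (func d)

theorem coeff_funcs (F : A⟦X⟧) (n : ℕ) : coeff n (funcs d F) = mon (coeff n F) 0 := by
  rw [funcs, coeff_map, func_apply]

theorem funcs_C (a : A) : funcs d (C a) = C (mon a 0) := by
  rw [funcs, map_C, func_apply]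

theorem funcs_X : funcs d X = X := by
  rw [funcs, map_X]

theorem cfs_funcs_mul (i : ℤ) (F : A⟦X⟧) (M : (Op d)⟦X⟧) :
    cfs i (funcs d F * M) = F * cfs i M := by
  ext n
  rw [coeff_cfs, coeff_mul, coeff_mul, map_sum]
  refine Finset.sum_congr rfl fun p _ => ?_
  rw [coeff_funcs, cf_func_mul, coeff_cfs]

theorem cfs_zero_funcs (F : A⟦X⟧) : cfs 0 (funcs d F) = F := by
  ext n
  rw [coeff_cfs, coeff_funcs, cf_mon, if_pos rfl]

theorem cfs_zero_one : cfs 0 (1 : (Op d)⟦X⟧) = 1 := by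
  rw [← map_one (funcs d), cfs_zero_funcs]

theorem cfs_X_mul (i : ℤ) (M : (Op d)⟦X⟧) : cfs i (X * M) = X * cfs i M := by
  rw [← funcs_X, cfs_funcs_mul]

theorem cfs_mul_of_diffOps {M N : (Op d)⟦X⟧} (hM : M ∈ coeffsIn (diffOps d))
    (hN : N ∈ coeffsIn (diffOps d)) : cfs 0 (M * N) = cfs 0 (M * funcs d (cfs 0 N)) := by
  ext n
  rw [coeff_cfs, coeff_cfs, coeff_mul, coeff_mul, map_sum, map_sum]
  refine Finset.sum_congr rfl fun p _ => ?_
  rw [cf_zero_mul_of_diffOps (hM _) (hN _), coeff_funcs, coeff_cfs]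

/-- The derivation acting on the coefficients of a power series of functions. -/
def dser (d : Derivation ℚ A A) : A⟦X⟧ →+ A⟦X⟧ where
  toFun F := PowerSeries.mk fun n => d (coeff n F)
  map_zero' := by ext n; simp
  map_add' F G := by ext n; simp

@[simp] theorem coeff_dser (F : A⟦X⟧) (n : ℕ) : coeff n (dser d F) = d (coeff n F) := by
  simp [dser]

theorem dser_C (a : A) : dser d (C a) = C (d a) := by
  ext n
  rw [coeff_dser, coeff_C, coeff_C, apply_ite d, map_zero]

theorem cfs_D_mul (i : ℤ) (M : (Op d)⟦X⟧) :
    cfs i (C (mon 1 1) * M) = dser d (cfs i M) + cfs (i - 1) M := by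
  ext n
  rw [coeff_cfs, coeff_C_mul, cf_D_mul, map_add, coeff_dser, coeff_cfs, coeff_cfs]

theorem D_mul_funcs (F : A⟦X⟧) : C (mon 1 1) * funcs d F =
    funcs d (dser d F) + funcs d F * C (mon 1 1) := by
  ext1 n
  rw [coeff_C_mul, map_add, coeff_mul_C, coeff_funcs, coeff_funcs, D_mul_mon, coeff_dser,
    ← mon_eq_mul, zero_add]

theorem cfs_eq_zero {M : (Op d)⟦X⟧} {N i : ℤ} (hM : M ∈ coeffsIn (ordLE d N)) (h : N < i) :
    cfs i M = 0 := by
  ext n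
  rw [coeff_cfs, hM n i h, map_zero]

theorem cfs_neg_eq_zero {M : (Op d)⟦X⟧} {i : ℤ} (hM : M ∈ coeffsIn (diffOps d)) (h : i < 0) :
    cfs i M = 0 := by
  ext n
  rw [coeff_cfs, hM n i h, map_zero]

theorem mul_mem_coeffsIn_ordLE {M N : ℤ} (K : ℤ) {F G : (Op d)⟦X⟧}
    (hF : F ∈ coeffsIn (ordLE d M)) (hG : G ∈ coeffsIn (ordLE d N)) (h : M + N ≤ K) :
    F * G ∈ coeffsIn (ordLE d K) :=
  mul_mem_coeffsIn (fun _ ha _ hb => ordLE_mono h (mul_mem_ordLE ha hb)) hF hG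

theorem coeffsIn_ordLE_mono {M N : ℤ} (h : M ≤ N) {F : (Op d)⟦X⟧}
    (hF : F ∈ coeffsIn (ordLE d M)) : F ∈ coeffsIn (ordLE d N) :=
  fun n => ordLE_mono h (hF n)

theorem mul_mem_coeffsIn_diffOps {F G : (Op d)⟦X⟧}
    (hF : F ∈ coeffsIn (diffOps d)) (hG : G ∈ coeffsIn (diffOps d)) :
    F * G ∈ coeffsIn (diffOps d) :=
  mul_mem_coeffsIn (fun _ ha _ hb => mul_mem_diffOps ha hb) hF hG

theorem funcs_mem_ordLE (F : A⟦X⟧) : funcs d F ∈ coeffsIn (ordLE d 0) := fun n => by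
  rw [coeff_funcs]; exact mon_mem_ordLE _ 0

theorem funcs_mem_diffOps (F : A⟦X⟧) : funcs d F ∈ coeffsIn (diffOps d) := fun n => by
  rw [coeff_funcs]; exact mon_mem_diffOps _ le_rfl

theorem one_mem_ordLE : (1 : (Op d)⟦X⟧) ∈ coeffsIn (ordLE d 0) := by
  rw [← map_one (funcs d)]; exact funcs_mem_ordLE 1

theorem one_mem_coeffsIn_diffOps : (1 : (Op d)⟦X⟧) ∈ coeffsIn (diffOps d) := by
  rw [← map_one (funcs d)]; exact funcs_mem_diffOps 1

theorem mem_ordLE_sub_one {F : (Op d)⟦X⟧} {N : ℤ} (hF : F ∈ coeffsIn (ordLE d N))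
    (h : cfs N F = 0) : F ∈ coeffsIn (ordLE d (N - 1)) := by
  intro n i hi
  rcases lt_or_ge N i with h' | h'
  · exact hF n i h'
  · obtain rfl : i = N := by omega
    simpa using congrArg (coeff n) h

/-- A power series `M` of differential operators that annihilate constants is zero if
`M (1 - X L)` consists of operators of order at most `0`. -/
theorem eq_zero_of_mul_mem_ordLE {M : (Op d)⟦X⟧} (L : Op d) (hM : M ∈ coeffsIn (diffOps d))
    (h0 : cfs 0 M = 0) (h : M * (1 - C L * X) ∈ coeffsIn (ordLE d 0)) : M = 0 := by
  -- A differential operator of order at most 0 is a function, and it vanishes if it kills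
  -- constants. The n-th coefficients of M and of M (1 - X L) differ by the previous coefficient of
  -- M times L, which is zero by induction.
  have key : ∀ n, coeff n M ∈ ordLE d 0 → coeff n M = 0 := by
    intro n hn
    ext i
    rcases lt_trichotomy i 0 with hi | rfl | hi
    · exact hM n i hi
    · simpa using congrArg (coeff n) h0
    · exact hn i hi
  rw [mul_sub, mul_one, ← mul_assoc] at h
  ext1 n
  rw [map_zero]
  induction n with
  | zero => exact key 0 (by simpa using h 0)
  | succ n ih =>
    refine key _ ?_
    have := h (n + 1)
    rwa [map_sub, coeff_succ_mul_X, coeff_mul_C, ih, zero_mul, sub_zero] at this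

end OpSeries

/-! ### The shift operator P and its factorization -/

/-- The effect of a derivation-like map on an inverse of `1 + q`. -/
theorem map_inv_one_add {T : Type*} [Ring T] (E : T →+ T)
    (hE : ∀ a b, E (a * b) = E a * b + a * E b) {q b g : T} (h : g * (1 + q) = 1)
    (h' : (1 + q) * g = 1) (hq : E q = q - 2 • (b * q - q * b)) :
    E g = g * g - g + 2 • (g * b - b * g) := by
  have hone : E 1 = 0 := by simpa using hE 1 1
  have h1 : E g * (1 + q) + g * E q = 0 := by
    rw [← hone, ← congrArg E h, hE, map_add, hone, zero_add]
  have h2 : g * q = 1 - g := by rw [← h]; noncomm_ring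
  have h3 : q * g = 1 - g := by rw [← h']; noncomm_ring
  have h4 : E g = -(g * E q * g) := by
    rw [← mul_one (E g), ← h', ← mul_assoc, eq_neg_of_add_eq_zero_left h1, neg_mul]
  calc E g = -(g * (q - 2 • (b * q - q * b)) * g) := by rw [h4, hq]
    _ = -((g * q) * g) + 2 • (g * b * (q * g) - (g * q) * b * g) := by noncomm_ring
    _ = g * g - g + 2 • (g * b - b * g) := by rw [h2, h3]; noncomm_ring

namespace BKP

open PDO (Op)
open PDO.Op OpSeries

variable {A : Type*} [CommRing A] [Algebra ℚ A]

/-- `∂/∂t_k`, for odd `k`, acting on the coefficients of operators. -/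
def opD (D : ℕ → Derivation ℚ A A) (k : ℕ) : Op (D 0) →+ Op (D 0) :=
  (mapCoeff (oddD D k)).toAddMonoidHom

theorem cf_opD (D : ℕ → Derivation ℚ A A) (k : ℕ) (P : Op (D 0)) (i : ℤ) :
    cf i (opD D k P) = oddD D k (cf i P) := rfl

theorem opD_zero (D : ℕ → Derivation ℚ A A) : opD D 0 = 0 := by
  ext P i
  rw [cf_opD, oddD_zero]
  rfl

theorem opD_mul (D : ℕ → Derivation ℚ A A)
    (hD : ∀ (m n : ℕ) (f : A), D m (D n f) = D n (D m f)) (k : ℕ) (P Q : Op (D 0)) :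
    opD D k (P * Q) = opD D k P * Q + P * opD D k Q := by
  by_cases h : Odd k
  · have := mapCoeff_mul (d := D 0) (D (k / 2)) (hD (k / 2) 0) P Q
    simpa [opD, oddD, h] using this
  · have h0 : ∀ P, opD D k P = 0 := fun P => by
      ext i
      simp [cf_opD, oddD, h]
    rw [h0, h0, h0, zero_mul, mul_zero, add_zero]

theorem opD_mon (D : ℕ → Derivation ℚ A A) (k : ℕ) (a : A) (i : ℤ) :
    opD D k (mon a i) = mon (oddD D k a) i :=
  mapCoeff_mon _ a i

theorem opD_one (D : ℕ → Derivation ℚ A A) (k : ℕ) : opD D k 1 = 0 := by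
  have : oddD D k 1 = 0 := by simpa using oddD_mul D k 1 1
  rw [one_def, opD_mon, this, ← func_apply, map_zero]

/-- The operator `X d/dX - 2 ∑ X^(2n+1) ∂/∂t_(2n+1)` on power series of operators. -/
def evolOp (D : ℕ → Derivation ℚ A A) : (Op (D 0))⟦X⟧ →+ (Op (D 0))⟦X⟧ := evol (opD D)

theorem evolOp_mul (D : ℕ → Derivation ℚ A A)
    (hD : ∀ (m n : ℕ) (f : A), D m (D n f) = D n (D m f)) (F G : (Op (D 0))⟦X⟧) :
    evolOp D (F * G) = evolOp D F * G + F * evolOp D G :=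
  evol_mul _ (opD_mul D hD) F G

theorem evolOp_one (D : ℕ → Derivation ℚ A A) : evolOp D 1 = 0 := by
  rw [← map_one C, evolOp, evol_C, neg_eq_zero]
  ext1 n
  rw [map_nsmul, coeff_mk, opD_one, smul_zero, map_zero]

/-- The generating series `∑ B_(2n+1) X^(2n+1)`. -/
def Bser (D : ℕ → Derivation ℚ A A) (L : PDO A) : (Op (D 0))⟦X⟧ :=
  PowerSeries.mk fun k => if Odd k then (Op.mk (B D L (k / 2)) : Op (D 0)) else 0

theorem coeff_zero_Bser (D : ℕ → Derivation ℚ A A) (L : PDO A) : coeff 0 (Bser D L) = 0 := by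
  simp [Bser]

theorem cf_Bser (D : ℕ → Derivation ℚ A A) (L : PDO A) (k : ℕ) (i : ℤ) :
    cf i (coeff k (Bser D L)) =
      if Odd k then if 0 ≤ i then cf i ((Op.mk L : Op (D 0)) ^ k) else 0 else 0 := by
  rw [Bser, coeff_mk]
  by_cases h : Odd k
  · rw [if_pos h, if_pos h, ← mk_pow]
    obtain ⟨n, rfl⟩ := h
    rw [show (2 * n + 1) / 2 = n by omega]
    rfl
  · rw [if_neg h, if_neg h, map_zero]

theorem Bser_mem_diffOps (D : ℕ → Derivation ℚ A A) (L : PDO A) :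
    Bser D L ∈ coeffsIn (diffOps (D 0)) := by
  intro k i hi
  rw [cf_Bser, if_neg hi.not_ge, ite_self]

section Lax

variable {D : ℕ → Derivation ℚ A A} {L : PDO A}

/-- The BKP constraint on the adjoint of L enters the proof here, as B(1) = 0. -/
theorem IsLax.cfs_zero_Bser (hL : IsLax D L) : cfs 0 (Bser D L) = 0 := by
  have hadj : adj (Op.mk L : Op (D 0)) = -(mon 1 1 * Op.mk L * mon 1 (-1)) :=
    PDO.Op.ext hL.adjoint_eq
  ext k
  rw [coeff_cfs, cf_Bser, map_zero]
  split_ifs with h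
  · exact cf_zero_pow hadj h
  · exact absurd le_rfl ‹_›
  · rfl

theorem IsLax.mem_ordLE (hL : IsLax D L) : (Op.mk L : Op (D 0)) ∈ ordLE (D 0) 1 :=
  hL.coeff_of_one_lt

theorem IsLax.opD_lax (hL : IsLax D L) (k : ℕ) : opD D k (Op.mk L) =
    coeff k (Bser D L) * Op.mk L - Op.mk L * coeff k (Bser D L) := by
  rw [Bser, coeff_mk]
  ext i
  rw [cf_opD, oddD]
  split_ifs with h
  · exact hL.lax (k / 2) i
  · simp

theorem IsLax.evolOp_q (hL : IsLax D L)
    (hD : ∀ (m n : ℕ) (f : A), D m (D n f) = D n (D m f)) :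
    evolOp D (C (Op.mk L) * X) = C (Op.mk L) * X -
      2 • (Bser D L * (C (Op.mk L) * X) - C (Op.mk L) * X * Bser D L) := by
  have h : (PowerSeries.mk fun n => opD D n (Op.mk L)) =
      Bser D L * C (Op.mk L) - C (Op.mk L) * Bser D L := by
    ext1 n
    rw [coeff_mk, hL.opD_lax, map_sub, coeff_mul_C, coeff_C_mul]
  rw [evolOp_mul D hD, evolOp, evol_C, evol_X _ (opD_one D), h, mul_assoc (C _) X,
    X_mul (φ := Bser D L)]
  noncomm_ring

/-- The conjugation of `X d/dX - 2 ∑ X^(2n+1) ∂/∂t_(2n+1)` by a solution of `E P = 2 P b`. -/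
theorem map_mul_two_nsmul_sub_one {T : Type*} [Ring T] (E : T →+ T)
    (hE : ∀ a b, E (a * b) = E a * b + a * E b) {P b g g' : T} (hP : E P = 2 • (P * b))
    (hg' : E g' = g' * g' - g' + 2 • (g' * b - b * g')) (h : 2 • (g' * g) = g + g') :
    E (P * (2 • g' - 1)) = -(P * (2 • g' - 1) * (g - g' - 2 • b)) := by
  have hone : E 1 = 0 := by simpa using hE 1 1
  have h1 : P * (2 • g' - 1) * (g - g' - 2 • b) = P * (2 • (g' * g)) -
      P * (2 • (g' * g') + g - g' + 2 • ((2 • g' - 1) * b)) := by noncomm_ring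
  rw [hE, hP, map_sub, map_nsmul, hone, sub_zero, hg', h1, h]
  noncomm_ring

/-- The difference of geometric series is twice the sum of the odd powers of X L, so what remains is
twice the integral parts (L^k)₋ for odd k. -/
theorem geom_sub_geom_neg_sub_mem (D : ℕ → Derivation ℚ A A) (L : PDO A) :
    geom (Op.mk L) - geom (-Op.mk L) - 2 • Bser D L ∈ coeffsIn (ordLE (D 0) (-1)) := by
  intro k i hi
  rw [map_sub, map_sub, map_nsmul, map_sub, map_sub, map_nsmul, cf_Bser, geom, geom, coeff_mk,
    coeff_mk]
  rcases Nat.even_or_odd k with h | h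
  · rw [h.neg_pow, if_neg (Nat.not_odd_iff_even.mpr h), smul_zero, sub_self, sub_zero]
  · rw [h.neg_pow, if_pos h, if_pos (by omega), map_neg, two_smul]
    abel

/-- The main properties of the operator `P` that represents the shift by `2 [z⁻¹]` on
eigenfunctions. -/
structure IsShiftOp (D : ℕ → Derivation ℚ A A) (L : PDO A) (P Z : (Op (D 0))⟦X⟧) : Prop where
  coeff_zero : coeff 0 P = 1
  evol_eq : evolOp D P = 2 • (P * Bser D L)
  mem_diffOps : P ∈ coeffsIn (diffOps (D 0))
  cfs_zero : cfs 0 P = 1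
  mem_ordLE : Z ∈ coeffsIn (ordLE (D 0) (-1))
  mul_eq : P * (1 - C (Op.mk L) * X) = (1 + Z) * (1 + C (Op.mk L) * X)

/-- Formally P (1 - X L)(1 + X L)⁻¹ = 1 + Z =: Y. The Lax equations give E Y = -Y K, where K is the
difference of the geometric series of L and -L minus 2 B. As K has negative order and Y = 1 at X =
0, so has Y - 1. -/
theorem IsLax.exists_isShiftOp (hL : IsLax D L)
    (hD : ∀ (m n : ℕ) (f : A), D m (D n f) = D n (D m f)) : ∃ P Z, IsShiftOp D L P Z := by
  obtain ⟨P, h0, hP⟩ := exists_evol_eq_mul (opD D) (opD_zero D) (2 • Bser D L)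
    (by rw [map_nsmul, coeff_zero_Bser, smul_zero]) 1
  have hP' : evolOp D P = 2 • (P * Bser D L) := by rw [evolOp, hP, mul_smul_comm]
  have hB := Bser_mem_diffOps D L
  have hdiff : P ∈ coeffsIn (diffOps (D 0)) := by
    refine mem_coeffsIn_of_evol_mul (opD D) (opD_zero D) _
      (fun k x hx => mapCoeff_mem_diffOps _ hx) (G := 2 • Bser D L)
      (by rw [map_nsmul, coeff_zero_Bser, smul_zero]) (fun k x hx => ?_)
      (by rw [h0]; exact one_mem_diffOps) (by rw [hP, sub_self]; exact zero_mem _)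
    rw [map_nsmul]
    exact mul_mem_diffOps hx (Submodule.smul_of_tower_mem _ 2 (hB k))
  -- E (P - 1) = 2 P B kills constants because B does, and the operators that kill constants are
  -- stable under the flows.
  have hcfs : cfs 0 (P - 1) = 0 := by
    have : P - 1 ∈ coeffsIn (LinearMap.ker (cf 0 : Op (D 0) →ₗ[ℚ] A)) := by
      refine mem_coeffsIn_of_evol (opD D) (opD_zero D) _ (fun k x hx => ?_)
        (by rw [map_sub, h0, coeff_zero_one, sub_self]; exact zero_mem _) ?_
      · rw [LinearMap.mem_ker] at hx ⊢
        rw [cf_opD, hx, map_zero]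
      · rw [map_sub, show evol (opD D) 1 = 0 from evolOp_one D, sub_zero, ← evolOp, hP']
        intro n
        rw [LinearMap.mem_ker, map_nsmul, map_nsmul, ← coeff_cfs,
          cfs_mul_of_diffOps hdiff hB, hL.cfs_zero_Bser, map_zero, mul_zero, map_zero, map_zero,
          smul_zero]
    ext n
    rw [coeff_cfs, map_zero]
    exact this n
  set q : (Op (D 0))⟦X⟧ := C (Op.mk L) * X with hq
  set g : (Op (D 0))⟦X⟧ := geom (Op.mk L) with hg
  set g' : (Op (D 0))⟦X⟧ := geom (-Op.mk L) with hg'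
  have hgl : (1 - q) * g = 1 := mul_geom _
  have hneg : 1 - C (-Op.mk L : Op (D 0)) * X = 1 + q := by
    rw [map_neg, neg_mul, sub_neg_eq_add]
  have hg'l : (1 + q) * g' = 1 := by rw [← hneg]; exact mul_geom _
  have hg'r : g' * (1 + q) = 1 := by rw [← hneg]; exact geom_mul _
  have hgg : 2 • (g' * g) = g + g' := by
    have : 2 • (g' * g) = (g' * (1 + q)) * g + g' * ((1 - q) * g) := by noncomm_ring
    rw [this, hg'r, hgl, one_mul, mul_one]
  have hEg' := map_inv_one_add (evolOp D) (evolOp_mul D hD) hg'r hg'l (hL.evolOp_q hD)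
  have hE := map_mul_two_nsmul_sub_one (evolOp D) (evolOp_mul D hD) hP' hEg' hgg
  have hK := geom_sub_geom_neg_sub_mem D L
  refine ⟨P, P * (2 • g' - 1) - 1, h0, hP', hdiff, ?_, ?_, ?_⟩
  · rw [map_sub, sub_eq_zero] at hcfs
    rw [hcfs, cfs_zero_one]
  · set K := g - g' - 2 • Bser D L with hKdef
    have hK0 : coeff 0 K = 0 := by
      rw [hKdef, map_sub, map_sub, map_nsmul, coeff_zero_Bser, hg, hg', geom, geom, coeff_mk,
        coeff_mk, pow_zero, pow_zero, sub_self, smul_zero, sub_zero]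
    refine mem_coeffsIn_of_evol_mul (opD D) (opD_zero D) _
      (fun k x hx => mapCoeff_mem_ordLE _ hx) (G := -K) (by rw [map_neg, hK0, neg_zero])
      (fun k x hx => ?_) ?_ ?_
    · rw [map_neg, mul_neg]
      exact neg_mem (ordLE_mono (by norm_num) (mul_mem_ordLE hx (hK k)))
    · rw [map_sub, coeff_mul, Finset.Nat.antidiagonal_zero, Finset.sum_singleton, h0, one_mul,
        map_sub, map_nsmul, coeff_zero_one, hg', geom, coeff_mk, pow_zero, two_smul,
        add_sub_cancel_right, sub_self]
      exact zero_mem _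
    · rw [map_sub, show evol (opD D) 1 = 0 from evolOp_one D, sub_zero,
        show evol (opD D) (P * (2 • g' - 1)) = _ from hE]
      -- In terms of Y - 1 the equation becomes E (Y - 1) = -(Y - 1) K - K, with inhomogeneous term
      -- of negative order.
      have : -(P * (2 • g' - 1) * K) - (P * (2 • g' - 1) - 1) * -K = -K := by noncomm_ring
      rw [this]
      exact neg_mem hK
  · have : (1 + (P * (2 • g' - 1) - 1)) * (1 + q) = P * (2 • (g' * (1 + q)) - (1 + q)) := by
      noncomm_ring
    rw [this, hg'r, two_smul]
    congr 1
    abel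

end Lax

end BKP

/-! ### Two operator identities for P and B -/

namespace BKP

open PDO (Op)
open PDO.Op OpSeries

variable {A : Type*} [CommRing A] [Algebra ℚ A]

section ShiftOp

variable {D : ℕ → Derivation ℚ A A} {L : PDO A} {P Z : (Op (D 0))⟦X⟧}

theorem IsLax.q_mem_ordLE (hL : IsLax D L) :
    C (Op.mk L) * X ∈ coeffsIn (ordLE (D 0) 1) := by
  rw [← X_mul]
  exact X_mul_mem_coeffsIn (C_mem_coeffsIn hL.mem_ordLE)

theorem IsLax.cfs_one_q (hL : IsLax D L) : cfs 1 (C (Op.mk L : Op (D 0)) * X) = X := by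
  have h : cfs 1 (C (Op.mk L : Op (D 0))) = 1 := by
    ext n
    rw [coeff_cfs, coeff_C, PowerSeries.coeff_one]
    split_ifs
    · exact hL.coeff_one
    · exact map_zero _
  rw [← X_mul, cfs_X_mul, h, mul_one]

theorem C_D_mem_diffOps : C (mon 1 1) ∈ coeffsIn (diffOps (D 0)) :=
  C_mem_coeffsIn (mon_mem_diffOps 1 zero_le_one)

theorem C_D_mem_ordLE : C (mon 1 1) ∈ coeffsIn (ordLE (D 0) 1) :=
  C_mem_coeffsIn (mon_mem_ordLE 1 1)

theorem IsShiftOp.Z_mul_mem (hL : IsLax D L) (h : IsShiftOp D L P Z) :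
    Z * (1 + C (Op.mk L) * X) ∈ coeffsIn (ordLE (D 0) 0) :=
  mul_mem_coeffsIn_ordLE 0 h.mem_ordLE
    (add_mem (coeffsIn_ordLE_mono zero_le_one one_mem_ordLE) hL.q_mem_ordLE) (by norm_num)

theorem IsShiftOp.sub_one_mul (h : IsShiftOp D L P Z) : (P - 1) * (1 - C (Op.mk L) * X) =
    2 • (C (Op.mk L) * X) + Z * (1 + C (Op.mk L) * X) := by
  rw [sub_mul, h.mul_eq]
  noncomm_ring

theorem IsShiftOp.add_one_mul (h : IsShiftOp D L P Z) : (P + 1) * (1 - C (Op.mk L) * X) =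
    2 + Z * (1 + C (Op.mk L) * X) := by
  rw [add_mul, h.mul_eq, ← one_add_one_eq_two]
  noncomm_ring

/-- Both ∂ (P + 1) and P - 1 kill constants since P(1) = 1. After multiplication by 1 - X L both
have order at most 1, so a single function u removes the coefficient of ∂ and leaves order at most
0. -/
theorem IsShiftOp.exists_first (hL : IsLax D L) (h : IsShiftOp D L P Z) :
    ∃ u : A⟦X⟧, X * (C (mon 1 1) * (P + 1)) = funcs (D 0) u * (P - 1) := by
  set q : (Op (D 0))⟦X⟧ := C (Op.mk L) * X with hq
  set E := Z * (1 + q) with hE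
  have hE0 : E ∈ coeffsIn (ordLE (D 0) 0) := h.Z_mul_mem hL
  have hone : (1 : (Op (D 0))⟦X⟧) ∈ coeffsIn (ordLE (D 0) 0) := one_mem_ordLE
  have h2 : (2 : (Op (D 0))⟦X⟧) ∈ coeffsIn (ordLE (D 0) 0) := by
    rw [← one_add_one_eq_two]
    exact add_mem hone hone
  -- The coefficients of ∂ to be matched are X (2 + E₀) and 2 X u, with E₀ the constant coefficient
  -- of E.
  set u : A⟦X⟧ := 1 + (2 : ℚ)⁻¹ • cfs 0 E with hu
  have h2u : u * (2 • X) = X * (2 + cfs 0 E) := by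
    have : (2 : A⟦X⟧) * ((2 : ℚ)⁻¹ • cfs 0 E) = cfs 0 E := by
      rw [mul_smul_comm, two_mul, ← two_smul ℚ, smul_smul, inv_mul_cancel₀ two_ne_zero, one_smul]
    rw [hu, two_smul]
    linear_combination X * this
  refine ⟨u, ?_⟩
  rw [← sub_eq_zero]
  refine eq_zero_of_mul_mem_ordLE (Op.mk L) ?_ ?_ ?_
  · refine sub_mem (X_mul_mem_coeffsIn (mul_mem_coeffsIn_diffOps C_D_mem_diffOps
      (add_mem h.mem_diffOps one_mem_coeffsIn_diffOps)))
      (mul_mem_coeffsIn_diffOps (funcs_mem_diffOps u)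
        (sub_mem h.mem_diffOps one_mem_coeffsIn_diffOps))
  · have h3 : P + 1 ∈ coeffsIn (diffOps (D 0)) := add_mem h.mem_diffOps one_mem_coeffsIn_diffOps
    have h4 : cfs 0 (P + 1) = 2 := by
      rw [map_add, h.cfs_zero, cfs_zero_one, one_add_one_eq_two]
    rw [map_sub, cfs_X_mul, cfs_D_mul, cfs_neg_eq_zero h3 (i := 0 - 1) (by norm_num),
      cfs_funcs_mul, map_sub, h4, h.cfs_zero, cfs_zero_one, sub_self, mul_zero, sub_zero, add_zero]
    have : dser (D 0) (2 : A⟦X⟧) = 0 := by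
      rw [show (2 : A⟦X⟧) = C 2 from (map_ofNat C 2).symm, dser_C]
      have : (D 0) (2 : A) = 0 := by simpa using (D 0).map_natCast 2
      rw [this, map_zero]
    rw [this, mul_zero]
  · rw [sub_mul, mul_assoc, mul_assoc, mul_assoc, h.sub_one_mul, h.add_one_mul, ← hq, ← hE]
    have hq2 : 2 • q + E ∈ coeffsIn (ordLE (D 0) 1) :=
      add_mem (nsmul_mem hL.q_mem_ordLE 2) (coeffsIn_ordLE_mono zero_le_one hE0)
    refine mem_ordLE_sub_one (N := 1) (sub_mem (X_mul_mem_coeffsIn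
      (mul_mem_coeffsIn_ordLE 1 C_D_mem_ordLE (add_mem h2 hE0) (by norm_num)))
      (mul_mem_coeffsIn_ordLE 1 (funcs_mem_ordLE u) hq2 (by norm_num))) ?_
    rw [map_sub, cfs_X_mul, cfs_D_mul, cfs_eq_zero (add_mem h2 hE0) zero_lt_one, map_zero,
      zero_add, sub_self, cfs_funcs_mul, map_add, map_add, cfs_eq_zero hE0 zero_lt_one, add_zero,
      map_nsmul, hL.cfs_one_q, ← one_add_one_eq_two, map_add, cfs_zero_one, one_add_one_eq_two,
      h2u, sub_self]

/-- Again both sides kill constants, now because B(1) = 0. The point is that U B (1 - X L), with U =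
X ∂ + u, has order at most 1 although B has unbounded order; the first identity, in the form U = (u
- X ∂) P, gives this. -/
theorem IsShiftOp.exists_second (hL : IsLax D L) (h : IsShiftOp D L P Z) {u : A⟦X⟧}
    (hu : X * (C (mon 1 1) * (P + 1)) = funcs (D 0) u * (P - 1)) :
    ∃ v : A⟦X⟧, (X * C (mon 1 1) + funcs (D 0) u) * Bser D L = funcs (D 0) v * (P - 1) := by
  set q : (Op (D 0))⟦X⟧ := C (Op.mk L) * X with hq
  set g' : (Op (D 0))⟦X⟧ := geom (-Op.mk L) with hg'
  set U := X * C (mon 1 1) + funcs (D 0) u with hU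
  have hneg : 1 - C (-Op.mk L : Op (D 0)) * X = 1 + q := by
    rw [map_neg, neg_mul, sub_neg_eq_add]
  have hg'l : (1 + q) * g' = 1 := by rw [← hneg]; exact mul_geom _
  have hg'r : g' * (1 + q) = 1 := by rw [← hneg]; exact geom_mul _
  have hgr : geom (Op.mk L) * (1 - q) = 1 := geom_mul _
  have hUord : U ∈ coeffsIn (ordLE (D 0) 1) :=
    add_mem (X_mul_mem_coeffsIn C_D_mem_ordLE)
      (coeffsIn_ordLE_mono zero_le_one (funcs_mem_ordLE u))
  have hUord' : funcs (D 0) u - X * C (mon 1 1) ∈ coeffsIn (ordLE (D 0) 1) :=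
    sub_mem (coeffsIn_ordLE_mono zero_le_one (funcs_mem_ordLE u))
      (X_mul_mem_coeffsIn C_D_mem_ordLE)
  have hUP : (funcs (D 0) u - X * C (mon 1 1)) * P = U := by
    rw [← mul_assoc] at hu
    have : (funcs (D 0) u - X * C (mon 1 1)) * P = funcs (D 0) u * (P - 1) -
        X * C (mon 1 1) * (P + 1) + U := by rw [hU]; noncomm_ring
    rw [this, hu, sub_self, zero_add]
  -- By the factorization of P, U (1 - q) g' = (u - X ∂)(1 + Z), and U (1 + q) g' = U; the two add
  -- up to 2 U g'.
  have hH : 2 • (U * g') ∈ coeffsIn (ordLE (D 0) 1) := by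
    have h1 : (1 - q) * g' = g' * (1 - q) := by
      calc (1 - q) * g' = 2 • g' - (1 + q) * g' := by noncomm_ring
        _ = 2 • g' - g' * (1 + q) := by rw [hg'l, hg'r]
        _ = g' * (1 - q) := by noncomm_ring
    have h2 : U * ((1 - q) * g') = (funcs (D 0) u - X * C (mon 1 1)) * (1 + Z) := by
      rw [← hUP, mul_assoc, ← mul_assoc P, h.mul_eq, mul_assoc (1 + Z), hg'l, mul_one]
    have h3 : 2 • (U * g') = U * ((1 + q) * g') + U * ((1 - q) * g') := by noncomm_ring
    rw [h3, hg'l, h2, mul_one]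
    exact add_mem hUord (mul_mem_coeffsIn_ordLE 1 hUord'
      (add_mem one_mem_ordLE (coeffsIn_ordLE_mono (by norm_num) h.mem_ordLE)) (by norm_num))
  set W := U * Bser D L * (1 - q) with hW
  have hq1 : 1 - q ∈ coeffsIn (ordLE (D 0) 1) :=
    sub_mem (coeffsIn_ordLE_mono zero_le_one one_mem_ordLE) hL.q_mem_ordLE
  have hWord : W ∈ coeffsIn (ordLE (D 0) 1) := by
    refine mem_coeffsIn_of_two_nsmul ?_
    -- Here 2 B is replaced by the difference of the geometric series up to an error of negative
    -- order.
    have h1 : 2 • W = U * (geom (Op.mk L) * (1 - q)) + U * (g' * (1 + q)) - 2 • (U * g') -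
        U * (geom (Op.mk L) - g' - 2 • Bser D L) * (1 - q) := by
      rw [hW]
      noncomm_ring
    rw [h1, hgr, hg'r, mul_one]
    exact sub_mem (sub_mem (add_mem hUord hUord) hH) (mul_mem_coeffsIn_ordLE 1
      (mul_mem_coeffsIn_ordLE 0 hUord (geom_sub_geom_neg_sub_mem D L) (by norm_num)) hq1
      (by norm_num))
  -- Division by X is possible because B, and hence W, has no constant term in X.
  obtain ⟨v, hv⟩ : ∃ v : A⟦X⟧, v * (2 • X) = cfs 1 W := by
    refine ⟨PowerSeries.mk fun n => (2 : ℚ)⁻¹ • coeff (n + 1) (cfs 1 W), ?_⟩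
    ext n
    rcases n with _ | n
    · have h0 : coeff 0 W = 0 := by
        rw [hW, coeff_mul, Finset.Nat.antidiagonal_zero, Finset.sum_singleton, coeff_mul,
          Finset.Nat.antidiagonal_zero, Finset.sum_singleton, coeff_zero_Bser, mul_zero, zero_mul]
      rw [coeff_cfs, h0, map_zero, mul_smul_comm, map_nsmul, coeff_zero_mul_X, smul_zero]
    · rw [mul_smul_comm, map_nsmul, coeff_succ_mul_X, coeff_mk, ← Nat.cast_smul_eq_nsmul ℚ,
        smul_smul, Nat.cast_ofNat, mul_inv_cancel₀ two_ne_zero, one_smul]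
  refine ⟨v, ?_⟩
  rw [← sub_eq_zero]
  have hP1 : P - 1 ∈ coeffsIn (diffOps (D 0)) := sub_mem h.mem_diffOps one_mem_coeffsIn_diffOps
  have hUdiff : U ∈ coeffsIn (diffOps (D 0)) :=
    add_mem (X_mul_mem_coeffsIn C_D_mem_diffOps) (funcs_mem_diffOps u)
  refine eq_zero_of_mul_mem_ordLE (Op.mk L) ?_ ?_ ?_
  · exact sub_mem (mul_mem_coeffsIn_diffOps hUdiff (Bser_mem_diffOps D L))
      (mul_mem_coeffsIn_diffOps (funcs_mem_diffOps v) hP1)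
  · rw [map_sub, cfs_mul_of_diffOps hUdiff (Bser_mem_diffOps D L), hL.cfs_zero_Bser, map_zero,
      mul_zero, cfs_funcs_mul, map_sub, h.cfs_zero, cfs_zero_one, sub_self, mul_zero, map_zero,
      sub_zero]
  · rw [sub_mul, mul_assoc (funcs _ v), h.sub_one_mul, ← hq]
    have hE0 := h.Z_mul_mem hL
    rw [← hq] at hE0
    refine mem_ordLE_sub_one (N := 1) (sub_mem hWord (mul_mem_coeffsIn_ordLE 1 (funcs_mem_ordLE v)
      (add_mem (nsmul_mem hL.q_mem_ordLE 2) (coeffsIn_ordLE_mono zero_le_one hE0))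
      (by norm_num))) ?_
    rw [map_sub, cfs_funcs_mul, map_add, map_nsmul, hL.cfs_one_q, cfs_eq_zero hE0 zero_lt_one,
      add_zero, hv, sub_self]

end ShiftOp

end BKP

/-! ### Values on eigenfunctions, residues, and the equation for Ω -/

namespace BKP

open PDO (Op)
open PDO.Op OpSeries

variable {A : Type*} [CommRing A] [Algebra ℚ A]

section Value

variable {D : ℕ → Derivation ℚ A A} {L : PDO A} {P Z : (Op (D 0))⟦X⟧}

/-- The value of a power series of operators on a function. -/
def value (M : (Op (D 0))⟦X⟧) (f : A) : A⟦X⟧ := cfs 0 (M * funcs (D 0) (C f))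

theorem value_mul {M N : (Op (D 0))⟦X⟧} (hM : M ∈ coeffsIn (diffOps (D 0)))
    (hN : N ∈ coeffsIn (diffOps (D 0))) (f : A) :
    value (M * N) f = cfs 0 (M * funcs (D 0) (value N f)) := by
  rw [value, mul_assoc, cfs_mul_of_diffOps hM
    (mul_mem_coeffsIn_diffOps hN (funcs_mem_diffOps _)), value]

theorem cfs_zero_D_mul_funcs (F : A⟦X⟧) :
    cfs 0 (C (mon 1 1) * funcs (D 0) F) = dser (D 0) F := by
  rw [cfs_D_mul, cfs_zero_funcs, cfs_neg_eq_zero (funcs_mem_diffOps F) (i := 0 - 1) (by norm_num),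
    add_zero]

theorem value_one (f : A) : value (1 : (Op (D 0))⟦X⟧) f = C f := by
  rw [value, one_mul, cfs_zero_funcs]

theorem value_add (M N : (Op (D 0))⟦X⟧) (f : A) : value (M + N) f = value M f + value N f := by
  rw [value, add_mul, map_add, value, value]

theorem value_sub (M N : (Op (D 0))⟦X⟧) (f : A) : value (M - N) f = value M f - value N f := by
  rw [value, sub_mul, map_sub, value, value]

theorem value_funcs_mul (F : A⟦X⟧) (M : (Op (D 0))⟦X⟧) (f : A) :
    value (funcs (D 0) F * M) f = F * value M f := by
  rw [value, mul_assoc, cfs_funcs_mul, value]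

theorem value_D_mul {M : (Op (D 0))⟦X⟧} (hM : M ∈ coeffsIn (diffOps (D 0))) (f : A) :
    value (C (mon 1 1) * M) f = dser (D 0) (value M f) := by
  rw [value_mul C_D_mem_diffOps hM, cfs_zero_D_mul_funcs]

theorem value_X_mul (M : (Op (D 0))⟦X⟧) (f : A) : value (X * M) f = X * value M f := by
  rw [value, mul_assoc, cfs_X_mul, value]

/-- The residues that define the squared eigenfunction potential, as a generating series. -/
def resSeries (D : ℕ → Derivation ℚ A A) (L : PDO A) (ψ φ : A) : A⟦X⟧ :=
  value (C (mon 1 (-1)) * (C (mon ψ 0) * Bser D L)) φ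

/-- The operator T = B(f) (P + 1) - (P(f) - f) B is an explicit primitive: u and v cancel from ∂T,
leaving 2 (∂(B(f)) + f_x B). This uses the two identities both as operators and evaluated at f;
neither f nor g need be an eigenfunction. -/
theorem two_nsmul_resSeries (h : IsShiftOp D L P Z) {u v : A⟦X⟧}
    (hu : X * (C (mon 1 1) * (P + 1)) = funcs (D 0) u * (P - 1))
    (hv : (X * C (mon 1 1) + funcs (D 0) u) * Bser D L = funcs (D 0) v * (P - 1)) (f g : A) :
    2 • resSeries D L (D 0 f) g =
      value (Bser D L) f * (value P g + C g) - (value P f - C f) * value (Bser D L) g := by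
  have hP1 : P + 1 ∈ coeffsIn (diffOps (D 0)) := add_mem h.mem_diffOps one_mem_coeffsIn_diffOps
  set B := Bser D L with hB
  have hBd : B ∈ coeffsIn (diffOps (D 0)) := Bser_mem_diffOps D L
  set b := value B f with hb
  set p := value P f with hp
  set ι := funcs (D 0) with hι
  set δ := dser (D 0) with hδ
  have hv' : X * (C (mon 1 1) * B) = ι v * (P - 1) - ι u * B := by
    rw [← hv]
    noncomm_ring
  have h1 : X * δ (p + C f) = u * (p - C f) := by
    have := congrArg (fun M => value M f) hu
    rwa [value_X_mul, value_D_mul hP1, value_funcs_mul, value_add, value_sub, value_one] at this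
  have h2 : X * δ b = v * (p - C f) - u * b := by
    have := congrArg (fun M => value M f) hv'
    rwa [value_X_mul, value_D_mul hBd, value_sub, value_funcs_mul, value_funcs_mul, value_sub,
      value_one] at this
  have h3 : X * δ (p - C f) = u * (p - C f) - 2 * (X * C (D 0 f)) := by
    rw [map_add, dser_C] at h1
    rw [map_sub, dser_C]
    linear_combination h1
  set T := ι b * (P + 1) - ι (p - C f) * B with hT
  have hXT : X * (C (mon 1 1) * T) = X * (2 • (ι (δ b) + ι (C (D 0 f)) * B)) := by
    have e1 : X * (C (mon 1 1) * T) = ι (X * δ b) * (P + 1) + ι b * (X * (C (mon 1 1) * (P + 1)))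
        - ι (X * δ (p - C f)) * B - ι (p - C f) * (X * (C (mon 1 1) * B)) := by
      have e3 : ∀ F M, X * (C (mon 1 1) * (ι F * M)) =
          ι (X * δ F) * M + ι F * (X * (C (mon 1 1) * M)) := by
        intro F M
        rw [← mul_assoc (C _), D_mul_funcs, map_mul, hι, funcs_X, ← hι, add_mul, mul_add,
          mul_assoc, ← mul_assoc X (ι F), X_mul (φ := ι F)]
        noncomm_ring
      rw [hT, mul_sub, mul_sub, e3, e3]
      noncomm_ring
    have e2 : X * (2 • (ι (δ b) + ι (C (D 0 f)) * B)) =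
        2 • ι (X * δ b) + 2 • (ι (X * C (D 0 f)) * B) := by
      rw [map_mul, map_mul, hι, funcs_X, ← hι]
      noncomm_ring
    rw [e1, e2, hu, hv', h2, h3]
    generalize p - C f = k
    have c : ∀ F G M, ι F * (ι G * M) = ι (F * G) * M := fun F G M => by
      rw [map_mul, mul_assoc]
    rw [mul_sub (ι k), c, c, c, mul_comm b u, mul_comm k v, mul_comm k u, map_sub, map_sub,
      two_mul, map_add]
    noncomm_ring
  have hT' : T = 2 • (C (mon 1 (-1)) * (ι (δ b) + ι (C (D 0 f)) * B)) := by
    have h4 : (C (mon 1 (-1)) : (Op (D 0))⟦X⟧) * C (mon 1 1) = 1 := by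
      rw [← map_mul, mon_one_mul_mon_one, neg_add_cancel, ← one_def, map_one]
    rw [← mul_smul_comm, ← X_mul_cancel hXT, ← mul_assoc, h4, one_mul]
  -- The term ∂⁻¹ ∂(B(f)) g has negative order, so it has no constant coefficient.
  have h5 : value (C (mon 1 (-1)) * ι (δ b)) g = 0 := by
    rw [value]
    refine cfs_eq_zero (N := -1) ?_ (by norm_num)
    exact mul_mem_coeffsIn_ordLE (-1) (mul_mem_coeffsIn_ordLE (-1)
      (C_mem_coeffsIn (mon_mem_ordLE 1 (-1))) (funcs_mem_ordLE _) (by norm_num))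
      (funcs_mem_ordLE _) (by norm_num)
  have h6 := congrArg (fun M => value M g) hT'
  rw [hT, value_sub, value_funcs_mul, value_funcs_mul, value_add, value_one, two_smul, value_add,
    mul_add (C (mon 1 (-1)) : (Op (D 0))⟦X⟧), value_add, h5, zero_add, hι, funcs_C] at h6
  rw [two_smul, resSeries, ← h6]

theorem value_Bser_of_isEigenfunction {f : A} (hf : IsEigenfunction D L f) :
    value (Bser D L) f = PowerSeries.mk fun k => oddD D k f := by
  ext k
  rw [value, funcs_C, coeff_cfs, coeff_mul_C, coeff_mk, cf_zero_mul_func, Bser, coeff_mk]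
  by_cases h : Odd k
  · rw [if_pos h, oddD, if_pos h]
    exact (hf (k / 2)).symm
  · rw [if_neg h, oddD, if_neg h, ← cf_zero_mul_func, zero_mul, map_zero, LinearMap.zero_apply]

theorem resSeries_of_isSEP {φ ψ S : A} (hS : IsSEP D L φ ψ S) :
    resSeries D L ψ φ = PowerSeries.mk fun k => oddD D k S := by
  ext k
  rw [resSeries, value, funcs_C, coeff_cfs, coeff_mul_C, coeff_C_mul, coeff_C_mul, coeff_mk, Bser,
    coeff_mk]
  by_cases h : Odd k
  · rw [if_pos h, oddD, if_pos h]
    refine Eq.trans ?_ (hS (k / 2)).symm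
    -- The last factor ∂⁻¹ in the residue shifts indices by one, turning the residue into a constant
    -- coefficient.
    have e := cf_mul_mon_one
      (mon 1 (-1) * mon ψ 0 * (Op.mk (B D L (k / 2)) : Op (D 0)) * mon φ 0) (-1) (-1)
    rw [sub_self] at e
    rw [← mul_assoc (mon 1 (-1)), ← e]
    rfl
  · rw [if_neg h, oddD, if_neg h, mul_zero, mul_zero, zero_mul, map_zero, LinearMap.zero_apply]

/-- E (P f) = 2 P B f as operators from P, and the eigenfunction equations contribute -2 P(B(f)); on
constant coefficients these cancel. Both sides equal f at X = 0, so uniqueness applies. -/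
theorem value_eq_shift (hD : ∀ (m n : ℕ) (f : A), D m (D n f) = D n (D m f))
    (h : IsShiftOp D L P Z) {f : A} (hf : IsEigenfunction D L f) :
    value P f = shift D 2 f := by
  have hev : evolA D (value P f) = 0 := by
    have h1 : ∀ M : (Op (D 0))⟦X⟧, evolA D (cfs 0 M) = cfs 0 (evolOp D M) := by
      intro M
      ext n
      rw [evolA, coeff_evol, coeff_cfs, coeff_cfs, evolOp, coeff_evol, map_sub, map_nsmul,
        map_nsmul, map_sum]
      congr 2
      refine Finset.sum_congr rfl fun p _ => ?_
      rw [coeff_cfs, cf_opD]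
      rfl
    have h2 : evolOp D (funcs (D 0) (C f)) = -(2 • funcs (D 0) (value (Bser D L) f)) := by
      rw [funcs_C, evolOp, evol_C, value_Bser_of_isEigenfunction hf]
      congr 2
      ext1 k
      rw [coeff_mk, opD_mon, coeff_funcs, coeff_mk]
    have h3 := value_mul h.mem_diffOps (Bser_mem_diffOps D L) f
    rw [value, h1, evolOp_mul D hD, h2, h.evol_eq, mul_neg, map_add, map_neg, mul_smul_comm,
      map_nsmul, ← h3, value, smul_mul_assoc, map_nsmul, add_neg_cancel]
  rw [← sub_eq_zero]
  refine eq_zero_of_evol (fun k => (oddD D k).toAddMonoidHom) (by simp [oddD_zero]; rfl) ?_ ?_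
  · rw [map_sub, coeff_zero_shift, value, funcs_C, coeff_cfs, coeff_mul_C, h.coeff_zero, one_mul,
      cf_mon, if_pos rfl, sub_self]
  · rw [map_sub]
    exact (congrArg₂ _ hev (evolA_shift D hD f)).trans (sub_self 0)

end Value

/-- E annihilates the shifted functions, so only the flows of Ω, f and g remain. The difference of
the residue formulas for (f, g) and (g, f) is 2 (B(f) P(g) - P(f) B(g)), which is E applied to the
right side. Only derivatives of the potentials enter, so their constants of integration do not
matter. -/
theorem shift_two_sub (D : ℕ → Derivation ℚ A A)
    (hD : ∀ (m n : ℕ) (f : A), D m (D n f) = D n (D m f))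
    (L : PDO A) (hL : IsLax D L) (f g : A) (hf : IsEigenfunction D L f)
    (hg : IsEigenfunction D L g) (Ω : A) (hΩ : IsBSEP D L f g Ω) :
    shift D 2 Ω - C Ω = shift D 2 f * C g - C f * shift D 2 g := by
  obtain ⟨P, Z, h⟩ := hL.exists_isShiftOp hD
  obtain ⟨u, hu⟩ := h.exists_first hL
  obtain ⟨v, hv⟩ := h.exists_second hL hu
  obtain ⟨S, S', hS, hS', rfl⟩ := hΩ
  have h1 := two_nsmul_resSeries h hu hv f g
  have h2 := two_nsmul_resSeries h hu hv g f
  rw [value_eq_shift hD h hf, value_eq_shift hD h hg] at h1 h2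
  rw [resSeries_of_isSEP hS] at h1
  rw [resSeries_of_isSEP hS'] at h2
  have hC : ∀ a : A, evolA D (C a) = -(2 • PowerSeries.mk fun k => oddD D k a) := fun a =>
    evol_C _ a
  rw [← sub_eq_zero]
  refine eq_zero_of_evol (fun k => (oddD D k).toAddMonoidHom) (by simp [oddD_zero]; rfl) ?_ ?_
  · simp only [map_sub, coeff_zero_shift, coeff_mul, Finset.Nat.antidiagonal_zero,
      Finset.sum_singleton, coeff_zero_C]
    ring
  · change evolA D _ = 0
    have hmul : ∀ F G, evolA D (F * G) = evolA D F * G + F * evolA D G :=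
      evol_mul _ (oddD_mul D)
    simp only [map_sub, hmul, evolA_shift D hD, hC]
    rw [h1, h2,
      value_Bser_of_isEigenfunction hf, value_Bser_of_isEigenfunction hg]
    simp only [two_smul]
    ring

end BKP

end

/-! ### Both signs of the shift -/

theorem mainTheorem8 {A : Type*} [CommRing A] [Algebra ℚ A]
    (D : ℕ → Derivation ℚ A A)
    (hD : ∀ (m n : ℕ) (f : A), D m (D n f) = D n (D m f))
    (L : PDO A) (hL : BKP.IsLax D L)
    (Φ₁ Φ₂ : A) (h₁ : BKP.IsEigenfunction D L Φ₁) (h₂ : BKP.IsEigenfunction D L Φ₂)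
    (Ω : A) (hΩ : BKP.IsBSEP D L Φ₁ Φ₂ Ω) :
    (BKP.shift D (-2) Ω - PowerSeries.C Ω =
      BKP.shift D (-2) Φ₁ * PowerSeries.C Φ₂ - PowerSeries.C Φ₁ * BKP.shift D (-2) Φ₂) ∧
    (BKP.shift D 2 Ω - PowerSeries.C Ω =
      BKP.shift D 2 Φ₁ * PowerSeries.C Φ₂ - PowerSeries.C Φ₁ * BKP.shift D 2 Φ₂) := by
  have h := BKP.shift_two_sub D hD L hL Φ₁ Φ₂ h₁ h₂ Ω hΩ
  refine ⟨?_, h⟩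
  have hC : ∀ a : A, PowerSeries.rescale (-1 : A) (PowerSeries.C a) = PowerSeries.C a := by
    intro a
    ext n
    rw [PowerSeries.coeff_rescale, PowerSeries.coeff_C]
    split_ifs with hn
    · rw [hn, pow_zero, one_mul]
    · rw [mul_zero]
  simpa only [map_sub, map_mul, BKP.rescale_shift, hC] using
    congrArg (PowerSeries.rescale (-1 : A)) h
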